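/- **Setting (stochastic contextual MNL bandit).** Let $1\le K\le N$ and let $\mathcal S$ be the family of subsets of $[N]$ of cardinality between $1$ and $K$. For $S\in\mathcal S$ and $v,r\in[0,1]^N$ put $\mu_i(S,v)=\frac{v_i}{1+\sum_{j\in S}v_j}$ for $i\in S$, $\mu_0(S,v)=\frac{1}{1+\sum_{j\in S}v_j}$, $\mu_i(S,v)=0$ otherwise, and $R(S,v,r)=\sum_{i\in S}\mu_i(S,v)r_i$. Let $\mathcal F$ be a class of functions $\mathcal X\to[0,1]^N$ containing the true value function $f^\star$, and let $\mathcal D$ be a probability distribution on $\mathcal X\times[0,1]^N$. In each round $t=1,\dots,T$ a pair $(x_t,r_t)\sim\mathcal D$ is drawn independently of the past, the learner sees it and chooses $S_t\in\mathcal S$, and then observes a purchase $i_t\sim\mu(S_t,f^\star(x_t))$. The regret is $$\mathrm{Reg}_{\mathsf{MNL}}=\mathbb E\Big[\sum_{t=1}^T\max_{S\in\mathcal S}R(S,f^\star(x_t),r_t)-\sum_{t=1}^TR(S_t,f^\star(x_t),r_t)\Big].$$ **Algorithm.** Let $\tau_0=0$, $\tau_m=2^{m-1}-1$ for $m\ge1$;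 epoch $m\geq 1$ consists of the rounds $\tau_m+1,\dots,\tau_{m+1}$. At the start of epoch $m$ the learner computes the empirical risk minimizer $f_m\in\operatorname{argmin}_{f\in\mathcal F}\sum_{t=\tau_{m-1}+1}^{\tau_m}-\log\mu_{i_t}(S_t,f(x_t))$. In each round $t$ of epoch $m$ it draws $S_t\sim q_m(x_t,r_t)$, where $$q_m(x,r)\in\operatorname{argmax}_{\rho\in\Delta(\mathcal S)}\ \mathbb E_{S\sim\rho}[R(S,f_m(x),r)]-\frac{(K+1)^4}{\gamma_m}\sum_{i=1}^N\log\frac1{w_i(\rho)},\qquad w_i(\rho)=\sum_{S\ni i}\rho(S),$$ with parameters $\gamma_m>0$ (ties are broken arbitrarily but measurably). **Statement.** There is a universal constant $C>0$ for which the following holds for all $1\le K\le N$ and $T\ge2$. * (Finite class) Let $\beta\in(0,1)$ and $M\in\mathbb N$. There are $\gamma_m>0$, depending only on $N,K,T,\beta,M$ (and $m$), such that for every finite class $\mathcal F$ with $|\mathcal F|=M$ of measurable functions with values in $[\beta,1]^N$, every $f^\star\in\mathcal F$ and every $\mathcal D$, $$\mathrm{Reg}_{\mathsf{MNL}}\le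 C\,K^2\sqrt{N\,T\,\log\big(\max\{K/\beta,\,2\}\big)\,\log(|\mathcal F|T)}.$$ * (Linear class) Let $d\ge1$ and $B>0$, and put $\bar B=\max\{B,2\}$. There are $\gamma_m>0$, depending only on $N,K,T,d,B$ (and $m$), such that for every $\mathcal X\subseteq\{x\in\mathbb R^{d\times N}:\|x_i\|_2\le1\ \ \forall i\in[N]\}$, the class $\mathcal F=\{x\mapsto(e^{\theta^\top x_i-B})_{i\in[N]}:\|\theta\|_2\le B\}$, every $f^\star\in\mathcal F$ and every $\mathcal D$, $$\mathrm{Reg}_{\mathsf{MNL}}\le C\,K^2\sqrt{d\,\bar B\,N\,T\,\log\bar B\,\log T}.$$ In particular neither bound depends on $\kappa=\max_{\|\theta\|\le B,\,S\in\mathcal S,\,i\in S,\,t\in[T]}\frac{1}{\mu_i(S,f_\theta(x_t))\,\mu_0(S,f_\theta(x_t))}$. -/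

import Mathlib

open MeasureTheory

noncomputable section

namespace MNLBandit

/-- Vectors of the cube `[0,1]^N`: item values and item rewards. -/
abbrev Cube (N : ℕ) := Fin N → unitInterval

/-- The admissible assortments: subsets of the `N` items of cardinality at least `1` and at
most `K`. -/
abbrev Assortment (N K : ℕ) := {S : Finset (Fin N) // 1 ≤ S.card ∧ S.card ≤ K}

instance (N K : ℕ) : MeasurableSpace (Assortment N K) := ⊤

instance (N K : ℕ) : DiscreteMeasurableSpace (Assortment N K) := ⟨fun _ => trivial⟩

/-- The multinomial logit probabilities. The outcome `0` is the no-purchase option (of value `1`),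
the outcome `i.succ` is the purchase of item `i`. -/
def choiceProb {N : ℕ} (S : Finset (Fin N)) (v : Cube N) : Fin (N + 1) → ℝ :=
  Fin.cons (1 / (1 + ∑ j ∈ S, (v j : ℝ)))
    (fun i => if i ∈ S then (v i : ℝ) / (1 + ∑ j ∈ S, (v j : ℝ)) else 0)

/-- Expected reward of the assortment `S` for values `v` and rewards `r` (no purchase pays `0`). -/
def expReward {N : ℕ} (S : Finset (Fin N)) (v r : Cube N) : ℝ :=
  ∑ i ∈ S, choiceProb S v i.succ * (r i : ℝ)

/-- Log loss of the choice model with values `v` on the assortment `S` and the outcome `i`. -/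
def logLoss {N : ℕ} (S : Finset (Fin N)) (v : Cube N) (i : Fin (N + 1)) : ℝ :=
  -Real.log (choiceProb S v i)

/-- A context-assortment-purchase tuple. -/
abbrev Sample (X : Type*) (N K : ℕ) := X × Assortment N K × Fin (N + 1)

/-- What happens in one round: context, reward vector, assortment, purchase decision. -/
abbrev Round (X : Type*) (N K : ℕ) := X × Cube N × Assortment N K × Fin (N + 1)

/-- `f` is an empirical log loss minimizer over the class `F` on the data set `D`. -/
def IsERM {X : Type*} {N K n : ℕ} (F : Set (X → Cube N)) (D : Fin n → Sample X N K)
    (f : X → Cube N) : Prop :=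
  f ∈ F ∧ ∀ g ∈ F, ∑ k, logLoss (D k).2.1 (f (D k).1) (D k).2.2 ≤
    ∑ k, logLoss (D k).2.1 (g (D k).1) (D k).2.2

/-- The probability that item `i` belongs to an assortment drawn from `ρ`. -/
def itemProb {N K : ℕ} (ρ : Assortment N K → ℝ) (i : Fin N) : ℝ :=
  ∑ S, if i ∈ S.1 then ρ S else 0

/-- The log-barrier regularized objective. -/
def barrierObjective {N K : ℕ} (γ : ℝ) (v r : Cube N) (ρ : Assortment N K → ℝ) : ℝ :=
  ∑ S, ρ S * expReward S.1 v r - ((K : ℝ) + 1) ^ 4 / γ * ∑ i, Real.log (1 / itemProb ρ i)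

/-- `ρ` maximizes the log-barrier regularized objective over the distributions on assortments.
As `log (1 / 0)` means `+∞` here, the objective is `-∞` at distributions under which some item has
probability `0`; these are therefore excluded, both as maximizers and as competitors. -/
def IsBarrierArgmax {N K : ℕ} (γ : ℝ) (v r : Cube N) (ρ : Assortment N K → ℝ) : Prop :=
  (ρ ∈ stdSimplex ℝ (Assortment N K) ∧ ∀ i, 0 < itemProb ρ i) ∧
    ∀ ρ' ∈ stdSimplex ℝ (Assortment N K), (∀ i, 0 < itemProb ρ' i) →
      barrierObjective γ v r ρ' ≤ barrierObjective γ v r ρ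

/-- The epoch schedule: `τ 0 = 0` and `τ m = 2 ^ (m - 1) - 1` for `m ≥ 1`. Epoch `m ≥ 1` consists of
the rounds `τ m + 1, …, τ (m + 1)`. -/
def τ (m : ℕ) : ℕ := 2 ^ (m - 1) - 1

/-- The epoch that round `t + 1` belongs to. -/
def epochOf (t : ℕ) : ℕ := Nat.log 2 (t + 1) + 1

theorem τ_epochOf_le (t : ℕ) : τ (epochOf t) ≤ t := by
  have := Nat.pow_log_le_self 2 (Nat.succ_ne_zero t)
  simp only [τ, epochOf, Nat.add_sub_cancel]
  simp only [Nat.succ_eq_add_one] at this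
  omega

theorem lt_τ_epochOf_succ (t : ℕ) : t < τ (epochOf t + 1) := by
  have := Nat.lt_pow_succ_log_self (b := 2) (by norm_num) (t + 1)
  simp only [τ, epochOf, Nat.add_sub_cancel]
  simp only [Nat.succ_eq_add_one] at this
  omega

/-- The data fed to the oracle at the beginning of epoch `m`: the tuples of the rounds
`τ (m - 1) + 1, …, τ m`. -/
abbrev EpochData (X : Type*) (N K m : ℕ) := Fin (τ m - τ (m - 1)) → Sample X N K

/-- The data of the previous epoch, read off from the first `t` rounds, for use in round `t + 1`
(round number `s + 1` is stored at position `s`). -/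
def epochData {X : Type*} {N K t : ℕ} (h : Fin t → Round X N K) : EpochData X N K (epochOf t) :=
  fun k =>
    let o := h ⟨τ (epochOf t - 1) + k, by have := τ_epochOf_le t; have := k.2; omega⟩
    (o.1, o.2.2)

/-- The epoch algorithm with ERM over `F` as the offline regression oracle and the log-barrier
policy with parameters `γ m`. At the beginning of epoch `m` the data of the previous epoch determine
a predictor in `F` and a stochastic policy. Ties in the argmin and in the argmax are broken
arbitrarily, but measurably. -/
structure BarrierERMAlgorithm {X : Type*} [MeasurableSpace X] {N : ℕ} (K : ℕ)
    (F : Set (X → Cube N)) (γ : ℕ → ℝ) where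
  predictor : (m : ℕ) → EpochData X N K m → X → Cube N
  policy : (m : ℕ) → EpochData X N K m → X → Cube N → Assortment N K → ℝ
  isERM : ∀ m D, IsERM F D (predictor m D)
  isBarrierArgmax : ∀ m D x r, IsBarrierArgmax (γ m) (predictor m D x) r (policy m D x r)
  measurable_predictor : ∀ m,
    Measurable fun p : EpochData X N K m × X => predictor m p.1 p.2
  measurable_policy : ∀ m,
    Measurable fun p : EpochData X N K m × X × Cube N => policy m p.1 p.2.1 p.2.2

variable {X : Type*} [MeasurableSpace X] {N K : ℕ} {F : Set (X → Cube N)} {γ : ℕ → ℝ}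

/-- Given the first `t` rounds `h`, and context `x` and rewards `r` of round `t + 1`: the law of
the first `t + 1` rounds, where the assortment is drawn from the policy of the current epoch and the
purchase decision from the choice model with the true values `fstar x`. -/
def stepLaw (A : BarrierERMAlgorithm K F γ) (fstar : X → Cube N) (t : ℕ)
    (p : (Fin t → Round X N K) × X × Cube N) : Measure (Fin (t + 1) → Round X N K) :=
  ∑ S : Assortment N K, ∑ i : Fin (N + 1),
    ENNReal.ofReal (A.policy (epochOf t) (epochData p.1) p.2.1 p.2.2 S *
        choiceProb S.1 (fstar p.2.1) i) •
      Measure.dirac (Fin.snoc (α := fun _ => Round X N K) p.1 (p.2.1, p.2.2, S, i))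

/-- The joint law of the first `t` rounds, when the context-reward pairs are drawn independently
from `𝒟` in each round. -/
def runLaw (𝒟 : Measure (X × Cube N)) (A : BarrierERMAlgorithm K F γ) (fstar : X → Cube N) :
    (t : ℕ) → Measure (Fin t → Round X N K)
  | 0 => Measure.dirac Fin.elim0
  | t + 1 => ((runLaw 𝒟 A fstar t).prod 𝒟).bind (stepLaw A fstar t)

/-- The gap between the total expected reward of the best assortments and that of the assortments
chosen in the rounds `h`. -/
def totalGap (fstar : X → Cube N) {T : ℕ} (h : Fin T → Round X N K) : ℝ :=
  ∑ t, (⨆ S : Assortment N K, expReward S.1 (fstar (h t).1) (h t).2.1) -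
    ∑ t, expReward (h t).2.2.1.1 (fstar (h t).1) (h t).2.1

/-- The expected regret after `T` rounds. -/
def regret (𝒟 : Measure (X × Cube N)) (A : BarrierERMAlgorithm K F γ) (fstar : X → Cube N)
    (T : ℕ) : ℝ :=
  ∫ h, totalGap fstar h ∂(runLaw 𝒟 A fstar T)

/-- The linear class on a set `𝒳` of `d × N` matrices, given by their columns: the functions
`x ↦ (exp (⟪θ, x i⟫ - B))_i` with `‖θ‖ ≤ B`. -/
def linearClass {d N : ℕ} (𝒳 : Set (Fin N → EuclideanSpace ℝ (Fin d))) (B : ℝ) :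
    Set (𝒳 → Cube N) :=
  {f | ∃ θ : EuclideanSpace ℝ (Fin d), ‖θ‖ ≤ B ∧
    ∀ (x : 𝒳) (i : Fin N), (f x i : ℝ) = Real.exp (inner ℝ θ (x.1 i) - B)}

theorem choiceProb_nonneg (S : Finset (Fin N)) (v : Cube N) (i : Fin (N + 1)) :
    0 ≤ choiceProb S v i := by
  have h0 : 0 ≤ ∑ j ∈ S, (v j : ℝ) := Finset.sum_nonneg fun j _ => (v j).2.1
  refine Fin.cases ?_ (fun i => ?_) i
  · simp only [choiceProb, Fin.cons_zero]; positivity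
  · simp only [choiceProb, Fin.cons_succ]
    have := (v i).2.1
    split_ifs <;> positivity

theorem sum_choiceProb (S : Finset (Fin N)) (v : Cube N) : ∑ i, choiceProb S v i = 1 := by
  have h0 : 0 ≤ ∑ j ∈ S, (v j : ℝ) := Finset.sum_nonneg fun j _ => (v j).2.1
  rw [Fin.sum_univ_succ]
  simp only [choiceProb, Fin.cons_zero, Fin.cons_succ, Finset.sum_ite_mem, Finset.univ_inter]
  rw [← Finset.sum_div]
  field_simp

theorem measurable_choiceProb {Y : Type*} [MeasurableSpace Y] (S : Finset (Fin N))
    (i : Fin (N + 1)) {g : Y → Cube N} (hg : Measurable g) :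
    Measurable fun y => choiceProb S (g y) i := by
  have hj : ∀ j, Measurable fun y => (g y j : ℝ) := fun j =>
    measurable_subtype_coe.comp ((measurable_pi_apply j).comp hg)
  refine Fin.cases ?_ (fun i => ?_) i
  · simp only [choiceProb, Fin.cons_zero]
    fun_prop
  · simp only [choiceProb, Fin.cons_succ]
    split_ifs <;> fun_prop

theorem measurable_epochData (t : ℕ) :
    Measurable (epochData : (Fin t → Round X N K) → EpochData X N K (epochOf t)) := by
  unfold epochData
  fun_prop

theorem measurable_stepLaw (A : BarrierERMAlgorithm K F γ) {fstar : X → Cube N}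
    (hf : Measurable fstar) (t : ℕ) : Measurable (stepLaw A fstar t) := by
  refine Measure.measurable_of_measurable_coe _ fun s hs => ?_
  simp only [stepLaw, Measure.coe_finsetSum, Finset.sum_apply, Measure.smul_apply, smul_eq_mul]
  refine Finset.measurable_sum _ fun S _ => Finset.measurable_sum _ fun i _ => ?_
  refine Measurable.mul (ENNReal.measurable_ofReal.comp (Measurable.mul ?_ ?_)) ?_
  · have h1 : Measurable fun p : (Fin t → Round X N K) × X × Cube N =>
        (epochData p.1, p.2) := ((measurable_epochData t).comp measurable_fst).prodMk measurable_snd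
    exact (measurable_pi_apply S).comp ((A.measurable_policy (epochOf t)).comp h1)
  · exact measurable_choiceProb _ _ (hf.comp (measurable_fst.comp measurable_snd))
  · have h2 : Measurable fun p : (Fin t → Round X N K) × X × Cube N =>
        (Fin.snoc (α := fun _ => Round X N K) p.1 (p.2.1, p.2.2, S, i) :
          Fin (t + 1) → Round X N K) := by
      refine measurable_pi_lambda _ fun k => ?_
      refine Fin.lastCases ?_ (fun k => ?_) k
      · simp only [Fin.snoc_last]; fun_prop
      · simp only [Fin.snoc_castSucc]; fun_prop
    exact (Measure.measurable_coe hs).comp (Measure.measurable_dirac.comp h2)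

theorem isProbabilityMeasure_stepLaw (A : BarrierERMAlgorithm K F γ) (fstar : X → Cube N) (t : ℕ)
    (p : (Fin t → Round X N K) × X × Cube N) : IsProbabilityMeasure (stepLaw A fstar t p) := by
  constructor
  obtain ⟨hn, hs⟩ := (A.isBarrierArgmax (epochOf t) (epochData p.1) p.2.1 p.2.2).1.1
  simp only [stepLaw, Measure.coe_finsetSum, Finset.sum_apply, Measure.smul_apply, smul_eq_mul,
    measure_univ, mul_one]
  rw [← ENNReal.ofReal_one, ← hs, ENNReal.ofReal_sum_of_nonneg fun S _ => hn S]
  refine Finset.sum_congr rfl fun S _ => ?_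
  rw [← ENNReal.ofReal_sum_of_nonneg fun i _ => mul_nonneg (hn S) (choiceProb_nonneg _ _ i),
    ← Finset.mul_sum, sum_choiceProb, mul_one]

/-- For a measurable value function the law of the run is indeed a probability measure. -/
theorem isProbabilityMeasure_runLaw (𝒟 : Measure (X × Cube N)) [IsProbabilityMeasure 𝒟]
    (A : BarrierERMAlgorithm K F γ) {fstar : X → Cube N} (hf : Measurable fstar) (t : ℕ) :
    IsProbabilityMeasure (runLaw 𝒟 A fstar t) := by
  induction t with
  | zero => exact Measure.dirac.isProbabilityMeasure
  | succ t ih =>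
    exact isProbabilityMeasure_bind (measurable_stepLaw A hf t).aemeasurable
      (Filter.Eventually.of_forall fun p => isProbabilityMeasure_stepLaw A fstar t p)

theorem measurable_expReward {Y : Type*} [MeasurableSpace Y] (S : Finset (Fin N))
    {g r : Y → Cube N} (hg : Measurable g) (hr : Measurable r) :
    Measurable fun y => expReward S (g y) (r y) := by
  refine Finset.measurable_sum _ fun i _ => (measurable_choiceProb S i.succ hg).mul ?_
  exact measurable_subtype_coe.comp ((measurable_pi_apply i).comp hr)

theorem expReward_mem_Icc (S : Finset (Fin N)) (v r : Cube N) :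
    expReward S v r ∈ Set.Icc (0 : ℝ) 1 := by
  refine ⟨Finset.sum_nonneg fun i _ => mul_nonneg (choiceProb_nonneg _ _ _) (r i).2.1, ?_⟩
  calc expReward S v r ≤ ∑ i ∈ S, choiceProb S v i.succ :=
        Finset.sum_le_sum fun i _ => mul_le_of_le_one_right (choiceProb_nonneg _ _ _) (r i).2.2
    _ ≤ ∑ i : Fin N, choiceProb S v i.succ :=
        Finset.sum_le_sum_of_subset_of_nonneg (Finset.subset_univ _)
          fun i _ _ => choiceProb_nonneg _ _ _
    _ ≤ ∑ i, choiceProb S v i := by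
        rw [Fin.sum_univ_succ (choiceProb S v)]
        exact le_add_of_nonneg_left (choiceProb_nonneg _ _ _)
    _ = 1 := sum_choiceProb S v

/-- The regret is the integral of an integrable function. -/
theorem integrable_totalGap (𝒟 : Measure (X × Cube N)) [IsProbabilityMeasure 𝒟]
    (A : BarrierERMAlgorithm K F γ) {fstar : X → Cube N} (hf : Measurable fstar) (T : ℕ) :
    Integrable (totalGap fstar) (runLaw 𝒟 A fstar T) := by
  have := isProbabilityMeasure_runLaw 𝒟 A hf T
  have hx : ∀ t : Fin T, Measurable fun h : Fin T → Round X N K => fstar (h t).1 := fun t =>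
    hf.comp (measurable_fst.comp (measurable_pi_apply t))
  have hr : ∀ t : Fin T, Measurable fun h : Fin T → Round X N K => (h t).2.1 := fun t => by
    fun_prop
  have hI : ∀ (t : Fin T) (g : (Fin T → Round X N K) → ℝ), Measurable g →
      (∀ h, g h ∈ Set.Icc (0 : ℝ) 1) → Integrable g (runLaw 𝒟 A fstar T) := fun _ g hg hb =>
    Integrable.of_bound hg.aestronglyMeasurable 1 (Filter.Eventually.of_forall fun h => by
      rw [Real.norm_eq_abs, abs_of_nonneg (hb h).1]; exact (hb h).2)
  refine Integrable.sub (integrable_finsetSum _ fun t _ => hI t _ ?_ fun h => ⟨?_, ?_⟩)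
    (integrable_finsetSum _ fun t _ => hI t _ ?_ fun h => expReward_mem_Icc _ _ _)
  · exact Measurable.iSup fun S => measurable_expReward S.1 (hx t) (hr t)
  · exact Real.iSup_nonneg fun S => (expReward_mem_Icc _ _ _).1
  · exact Real.iSup_le (fun S => (expReward_mem_Icc _ _ _).2) zero_le_one
  · have h1 : ∀ S : Assortment N K, Measurable fun h : Fin T → Round X N K =>
        if (h t).2.2.1 = S then expReward S.1 (fstar (h t).1) (h t).2.1 else 0 := fun S =>
      Measurable.ite (measurableSet_eq_fun (by fun_prop) measurable_const)
        (measurable_expReward S.1 (hx t) (hr t)) measurable_const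
    have h2 := Finset.measurable_sum (Finset.univ : Finset (Assortment N K)) fun S _ => h1 S
    simpa only [Finset.sum_ite_eq, Finset.mem_univ, if_true] using h2

end MNLBandit

end

open MeasureTheory

noncomputable section

namespace MNLBandit

/-! ### Choice probabilities, Hellinger affinity and rewards -/

section

variable {N K : ℕ}

/-! The proof transfers offline guarantees for maximum likelihood to regret, with the Hellinger
distance as the only link between the two. With `Λ = (K+1)^4 / γ`, first-order optimality of the
barrier policy towards the point mass at an assortment `S` (`IsBarrierArgmax.expReward_add_le`) says
two things at once: the policy loses at most `Λ N` according to its own predictor, and `Λ ∑_{i ∈ S}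
1 / w_i` is at most `Λ N` plus the predicted gap of `S`, so bad assortments may be covered badly but
good ones are covered well.

Rewards are Lipschitz in the values, and the squared value error on `S` is at most `16 (K+1)^4`
times one minus the affinity (`sum_sq_value_sub_le`). No inverse choice probability enters, hence no
`κ`. With the coverage bound and AM-GM, a predictor with small Hellinger loss under the last policy
estimates every assortment, up to an eighth of its predicted gap
(`IsBarrierArgmax.abs_expReward_sub_le`). By induction over the epochs, predicted and true gaps
agree up to a factor 2 and an additive error (`rewardGap_epochPredictor_comparison`).

The Hellinger loss of the likelihood maximizer is bounded through the square root of the likelihood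
ratio, which is an exponential supermartingale after compensation by the loss
(`lintegral_exp_logRatio_le`). Summing it over a finite multiplicative net gives expected loss of
order `log |net| / n` after an epoch of length `n`. Only positivity of the values is used, not the
size of the log loss, so the factors `log (K / β)` and `max B 2` of the theorem are not needed for
this estimate.

The choice of `γ` in `barrierParam` balances `Λ N` with `γ` times this loss; each round then costs
`O(K^2 √(N L / t))` with `L` a bound for the net term, and the sum over `t` is `regret_le_of_net`.
The finite class is its own net; the linear class has a grid. -/

theorem choiceProb_zero (S : Finset (Fin N)) (v : Cube N) :
    choiceProb S v 0 = 1 / (1 + ∑ j ∈ S, (v j : ℝ)) := rfl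

theorem choiceProb_succ (S : Finset (Fin N)) (v : Cube N) (i : Fin N) :
    choiceProb S v i.succ = if i ∈ S then (v i : ℝ) / (1 + ∑ j ∈ S, (v j : ℝ)) else 0 := rfl

theorem sum_value_nonneg (S : Finset (Fin N)) (v : Cube N) : 0 ≤ ∑ j ∈ S, (v j : ℝ) :=
  Finset.sum_nonneg fun j _ => (v j).2.1

theorem sum_value_le_card (S : Finset (Fin N)) (v : Cube N) : ∑ j ∈ S, (v j : ℝ) ≤ S.card := by
  simpa using Finset.sum_le_sum fun j (_ : j ∈ S) => (v j).2.2

theorem choiceProb_le_one (S : Finset (Fin N)) (v : Cube N) (i : Fin (N + 1)) :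
    choiceProb S v i ≤ 1 := by
  rw [← sum_choiceProb S v]
  exact Finset.single_le_sum (fun j _ => choiceProb_nonneg S v j) (Finset.mem_univ i)

/-- The Bhattacharyya coefficient of the choice models with values `v` and `v'`. -/
def affinity (S : Finset (Fin N)) (v v' : Cube N) : ℝ :=
  ∑ i, √(choiceProb S v i * choiceProb S v' i)

theorem affinity_nonneg (S : Finset (Fin N)) (v v' : Cube N) : 0 ≤ affinity S v v' :=
  Finset.sum_nonneg fun _ _ => Real.sqrt_nonneg _

theorem sum_sq_sqrt_sub (S : Finset (Fin N)) (v v' : Cube N) :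
    ∑ i, (√(choiceProb S v i) - √(choiceProb S v' i)) ^ 2 = 2 * (1 - affinity S v v') := by
  have h : ∀ i, (√(choiceProb S v i) - √(choiceProb S v' i)) ^ 2 =
      choiceProb S v i + choiceProb S v' i - 2 * √(choiceProb S v i * choiceProb S v' i) := by
    intro i
    rw [Real.sqrt_mul (choiceProb_nonneg S v i), sub_sq, Real.sq_sqrt (choiceProb_nonneg S v i),
      Real.sq_sqrt (choiceProb_nonneg S v' i)]
    ring
  simp only [h, Finset.sum_sub_distrib, Finset.sum_add_distrib, sum_choiceProb, ← Finset.mul_sum]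
  rw [affinity]
  ring

theorem affinity_le_one (S : Finset (Fin N)) (v v' : Cube N) : affinity S v v' ≤ 1 := by
  have := sum_sq_sqrt_sub S v v'
  have h : 0 ≤ ∑ i, (√(choiceProb S v i) - √(choiceProb S v' i)) ^ 2 :=
    Finset.sum_nonneg fun _ _ => sq_nonneg _
  linarith

/-- Factor `a^2 - b^2 = (a + b)(a - b)` for the square roots of the probabilities: `a + b ≤ 2` costs
a factor 4 over the squared Hellinger distance. -/
theorem sum_sq_choiceProb_sub_le (S : Finset (Fin N)) (v v' : Cube N) :
    ∑ i, (choiceProb S v i - choiceProb S v' i) ^ 2 ≤ 8 * (1 - affinity S v v') := by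
  have h : ∀ i, (choiceProb S v i - choiceProb S v' i) ^ 2 ≤
      4 * (√(choiceProb S v i) - √(choiceProb S v' i)) ^ 2 := by
    intro i
    have ha := Real.sq_sqrt (choiceProb_nonneg S v i)
    have hb := Real.sq_sqrt (choiceProb_nonneg S v' i)
    have ha1 := Real.sqrt_le_one.2 (choiceProb_le_one S v i)
    have hb1 := Real.sqrt_le_one.2 (choiceProb_le_one S v' i)
    have ha0 := Real.sqrt_nonneg (choiceProb S v i)
    have hb0 := Real.sqrt_nonneg (choiceProb S v' i)
    set a := √(choiceProb S v i)
    set b := √(choiceProb S v' i)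
    rw [← ha, ← hb, show (a ^ 2 - b ^ 2) ^ 2 = (a + b) ^ 2 * (a - b) ^ 2 by ring]
    refine mul_le_mul_of_nonneg_right ?_ (sq_nonneg _)
    nlinarith
  refine (Finset.sum_le_sum fun i _ => h i).trans ?_
  rw [← Finset.mul_sum, sum_sq_sqrt_sub]
  linarith

/-- The values are recovered from the probabilities as `v_i = μ_i / μ_0`, and `1 / μ_0 ≤ K + 1` is
the only loss, whatever the size of `μ_i`. The argument gives `(K+1)^3`; it is weakened to match the
weight of the regularizer. -/
theorem sum_sq_value_sub_le (S : Finset (Fin N)) (hS : S.card ≤ K) (v v' : Cube N) :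
    ∑ i ∈ S, ((v i : ℝ) - v' i) ^ 2 ≤ 16 * ((K : ℝ) + 1) ^ 4 * (1 - affinity S v v') := by
  have hK : (S.card : ℝ) ≤ K := by exact_mod_cast hS
  have hV0 := sum_value_nonneg S v
  have hV1 := (sum_value_le_card S v).trans hK
  have hV'0 := sum_value_nonneg S v'
  have key : ∀ i ∈ S, ((v i : ℝ) - v' i) ^ 2 ≤ 2 * ((K : ℝ) + 1) ^ 2 *
      ((choiceProb S v i.succ - choiceProb S v' i.succ) ^ 2 +
        (choiceProb S v 0 - choiceProb S v' 0) ^ 2) := by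
    intro i hi
    -- As `μ'_i = v'_i μ'_0`, the bracket is `μ_i - v'_i μ_0`, which the denominator turns into `v_i
    -- - v'_i`.
    have h1 : (v i : ℝ) - v' i = (1 + ∑ j ∈ S, (v j : ℝ)) *
        ((choiceProb S v i.succ - choiceProb S v' i.succ) -
          v' i * (choiceProb S v 0 - choiceProb S v' 0)) := by
      rw [choiceProb_succ, choiceProb_succ, choiceProb_zero, choiceProb_zero, if_pos hi, if_pos hi]
      field_simp
      ring
    have hv0 := (v' i).2.1
    have hv1 := (v' i).2.2
    rw [h1, mul_pow]
    generalize choiceProb S v i.succ - choiceProb S v' i.succ = a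
    generalize choiceProb S v 0 - choiceProb S v' 0 = b
    have h2 : (a - v' i * b) ^ 2 ≤ 2 * (a ^ 2 + b ^ 2) := by
      have h3 : (v' i * b : ℝ) ^ 2 ≤ b ^ 2 := by
        rw [mul_pow]
        exact mul_le_of_le_one_left (sq_nonneg b) (pow_le_one₀ hv0 hv1)
      nlinarith [sq_nonneg (a + v' i * b)]
    have h4 : (1 + ∑ j ∈ S, (v j : ℝ)) ^ 2 ≤ ((K : ℝ) + 1) ^ 2 :=
      pow_le_pow_left₀ (by linarith) (by linarith) 2
    calc _ ≤ ((K : ℝ) + 1) ^ 2 * (2 * (a ^ 2 + b ^ 2)) := by gcongr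
      _ = _ := by ring
  have hs := sum_sq_choiceProb_sub_le S v v'
  rw [Fin.sum_univ_succ] at hs
  have hsub : ∑ i ∈ S, (choiceProb S v i.succ - choiceProb S v' i.succ) ^ 2 ≤
      ∑ i : Fin N, (choiceProb S v i.succ - choiceProb S v' i.succ) ^ 2 :=
    Finset.sum_le_sum_of_subset_of_nonneg (Finset.subset_univ _) fun _ _ _ => sq_nonneg _
  refine (Finset.sum_le_sum key).trans ?_
  rw [← Finset.mul_sum, Finset.sum_add_distrib, Finset.sum_const, nsmul_eq_mul]
  have hK0 : (0 : ℝ) ≤ K := K.cast_nonneg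
  generalize ∑ i ∈ S, (choiceProb S v i.succ - choiceProb S v' i.succ) ^ 2 = a at *
  have hb : (0 : ℝ) ≤ (choiceProb S v 0 - choiceProb S v' 0) ^ 2 := sq_nonneg _
  have ha : 0 ≤ ∑ i : Fin N, (choiceProb S v i.succ - choiceProb S v' i.succ) ^ 2 :=
    Finset.sum_nonneg fun _ _ => sq_nonneg _
  generalize (choiceProb S v 0 - choiceProb S v' 0) ^ 2 = b at *
  have h5 : a + S.card * b ≤ ((K : ℝ) + 1) ^ 2 * (8 * (1 - affinity S v v')) := by
    have : a + S.card * b ≤ ((K : ℝ) + 1) * (8 * (1 - affinity S v v')) := by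
      have : (S.card : ℝ) * b ≤ K * b := by gcongr
      nlinarith
    refine this.trans (mul_le_mul_of_nonneg_right (by nlinarith) ?_)
    linarith
  calc 2 * ((K : ℝ) + 1) ^ 2 * (a + S.card * b)
      ≤ 2 * ((K : ℝ) + 1) ^ 2 * (((K : ℝ) + 1) ^ 2 * (8 * (1 - affinity S v v'))) := by gcongr
    _ = _ := by ring

theorem expReward_eq_div (S : Finset (Fin N)) (v r : Cube N) :
    expReward S v r = (∑ i ∈ S, (v i : ℝ) * r i) / (1 + ∑ j ∈ S, (v j : ℝ)) := by
  rw [expReward, Finset.sum_div]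
  refine Finset.sum_congr rfl fun i hi => ?_
  rw [choiceProb_succ, if_pos hi]
  ring

theorem abs_expReward_sub_le (S : Finset (Fin N)) (v v' r : Cube N) :
    |expReward S v r - expReward S v' r| ≤ ∑ i ∈ S, |(v i : ℝ) - v' i| := by
  have hV := sum_value_nonneg S v
  have hV' := sum_value_nonneg S v'
  obtain ⟨hR0, hR1⟩ := expReward_mem_Icc S v' r
  -- Subtracting the baseline `R(S, v')` from the rewards leaves a single denominator `≥ 1` and
  -- coefficients `r_i - R(S, v')` in `[-1, 1]`.
  have h : expReward S v r - expReward S v' r =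
      (∑ i ∈ S, (r i - expReward S v' r) * ((v i : ℝ) - v' i)) / (1 + ∑ j ∈ S, (v j : ℝ)) := by
    have h1 : ∑ i ∈ S, (r i - expReward S v' r) * ((v i : ℝ) - v' i) =
        (∑ i ∈ S, (v i : ℝ) * r i - ∑ i ∈ S, (v' i : ℝ) * r i) -
          expReward S v' r * (∑ i ∈ S, (v i : ℝ) - ∑ i ∈ S, (v' i : ℝ)) := by
      rw [← Finset.sum_sub_distrib, ← Finset.sum_sub_distrib, Finset.mul_sum,
        ← Finset.sum_sub_distrib]
      exact Finset.sum_congr rfl fun i _ => by ring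
    rw [h1, expReward_eq_div S v r, expReward_eq_div S v' r]
    field_simp
    ring
  rw [h, abs_div, abs_of_pos (by linarith : 0 < 1 + ∑ j ∈ S, (v j : ℝ))]
  refine (div_le_self (abs_nonneg _) (by linarith)).trans ?_
  refine (Finset.abs_sum_le_sum_abs _ _).trans (Finset.sum_le_sum fun i _ => ?_)
  rw [abs_mul]
  refine mul_le_of_le_one_left (abs_nonneg _) (abs_le.2 ?_)
  have := (r i).2.1
  have := (r i).2.2
  constructor <;> linarith

/-! ### Optimality of the log-barrier policy and its consequences -/

theorem itemProb_single (S : Assortment N K) (i : Fin N) :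
    itemProb (Pi.single S 1) i = if i ∈ S.1 then 1 else 0 := by
  classical
  rw [itemProb, Finset.sum_eq_single S]
  · simp
  · intro S' _ h; simp [h]
  · simp

theorem itemProb_mix (ρ ρ' : Assortment N K → ℝ) (a b : ℝ) (i : Fin N) :
    itemProb (a • ρ + b • ρ') i = a * itemProb ρ i + b * itemProb ρ' i := by
  simp only [itemProb, Finset.mul_sum, ← Finset.sum_add_distrib]
  refine Finset.sum_congr rfl fun S _ => ?_
  split_ifs <;> simp

/-- First-order optimality of the log-barrier policy in the direction of the assortment `S`. -/
theorem IsBarrierArgmax.expReward_add_le {γ : ℝ} (hγ : 0 < γ) {v r : Cube N}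
    {ρ : Assortment N K → ℝ} (h : IsBarrierArgmax γ v r ρ) (S : Assortment N K) :
    expReward S.1 v r + ((K : ℝ) + 1) ^ 4 / γ * ∑ i ∈ S.1, 1 / itemProb ρ i ≤
      ∑ S', ρ S' * expReward S'.1 v r + ((K : ℝ) + 1) ^ 4 / γ * N := by
  classical
  obtain ⟨⟨hρ, hw⟩, hmax⟩ := h
  set Λ : ℝ := ((K : ℝ) + 1) ^ 4 / γ with hΛ
  have hΛ0 : 0 < Λ := by positivity
  -- Moving mass `ε` from `ρ` to the point mass at `S` multiplies the probability of item `i` by `1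
  -- + ε u i`, which stays positive for `ε < 1`.
  set u : Fin N → ℝ := fun i => (if i ∈ S.1 then 1 else 0) / itemProb ρ i - 1 with hu
  have hu1 : ∀ i, -1 ≤ u i := fun i => by
    have : 0 ≤ (if i ∈ S.1 then (1 : ℝ) else 0) / itemProb ρ i := by
      have := hw i
      split_ifs <;> positivity
    simp only [hu]; linarith
  have hpos : ∀ ε ∈ Set.Ioo (0 : ℝ) 1, ∀ i, 0 < 1 + ε * u i := fun ε hε i => by
    nlinarith [hε.1, hε.2, hu1 i]
  -- The bound `log (1 + x) ≥ x / (1 + x)` replaces differentiation: divide the optimality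
  -- inequality by `ε`, then let `ε → 0`.
  have key : ∀ ε ∈ Set.Ioo (0 : ℝ) 1, expReward S.1 v r + Λ * ∑ i, u i / (1 + ε * u i) ≤
      ∑ S', ρ S' * expReward S'.1 v r := by
    intro ε hε
    have hw' : ∀ i, itemProb ((1 - ε) • ρ + ε • Pi.single S (1 : ℝ)) i =
        itemProb ρ i * (1 + ε * u i) := fun i => by
      rw [itemProb_mix, itemProb_single, hu]
      have := (hw i).ne'
      field_simp
      ring
    have hle := hmax ((1 - ε) • ρ + ε • Pi.single S (1 : ℝ))
      ((convex_stdSimplex ℝ _) hρ (single_mem_stdSimplex ℝ S) (by linarith [hε.2]) hε.1.le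
        (by ring))
      fun i => by rw [hw']; exact mul_pos (hw i) (hpos ε hε i)
    have hlin : ∑ S', ((1 - ε) • ρ + ε • Pi.single S (1 : ℝ) : Assortment N K → ℝ) S' *
        expReward S'.1 v r = (1 - ε) * ∑ S', ρ S' * expReward S'.1 v r +
          ε * expReward S.1 v r := by
      simp only [Pi.add_apply, Pi.smul_apply, smul_eq_mul, add_mul, Finset.sum_add_distrib,
        mul_assoc, ← Finset.mul_sum]
      congr 2
      rw [Finset.sum_eq_single S] <;> simp +contextual
    have hlog : ∑ i, Real.log (1 / itemProb ((1 - ε) • ρ + ε • Pi.single S (1 : ℝ)) i) ≤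
        ∑ i, Real.log (1 / itemProb ρ i) - ε * ∑ i, u i / (1 + ε * u i) := by
      rw [Finset.mul_sum, ← Finset.sum_sub_distrib]
      refine Finset.sum_le_sum fun i _ => ?_
      rw [hw', one_div, one_div, Real.log_inv, Real.log_inv,
        Real.log_mul (hw i).ne' (hpos ε hε i).ne']
      have h1 := Real.one_sub_inv_le_log_of_pos (hpos ε hε i)
      have h2 : 1 - (1 + ε * u i)⁻¹ = ε * (u i / (1 + ε * u i)) := by
        have := (hpos ε hε i).ne'
        field_simp
        ring
      linarith
    simp only [barrierObjective, hlin, ← hΛ] at hle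
    have h3 := mul_le_mul_of_nonneg_left hlog hΛ0.le
    have h4 : ε * (expReward S.1 v r + Λ * ∑ i, u i / (1 + ε * u i)) ≤
        ε * ∑ S', ρ S' * expReward S'.1 v r := by
      nlinarith
    exact le_of_mul_le_mul_left h4 hε.1
  have hlim : Filter.Tendsto (fun ε : ℝ => expReward S.1 v r + Λ * ∑ i, u i / (1 + ε * u i))
      (nhdsWithin 0 (Set.Ioi 0)) (nhds (expReward S.1 v r + Λ * ∑ i, u i / (1 + 0 * u i))) := by
    refine Filter.Tendsto.mono_left ?_ nhdsWithin_le_nhds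
    refine tendsto_const_nhds.add (tendsto_const_nhds.mul (tendsto_finsetSum _ fun i _ => ?_))
    refine tendsto_const_nhds.div ?_ (by simp)
    exact (tendsto_const_nhds.add (Filter.tendsto_id.mul tendsto_const_nhds))
  have hle := le_of_tendsto hlim (by
    filter_upwards [Ioo_mem_nhdsGT (zero_lt_one : (0 : ℝ) < 1)] with ε hε using key ε hε)
  have hsum : ∑ i, u i / (1 + 0 * u i) = ∑ i ∈ S.1, 1 / itemProb ρ i - N := by
    simp [hu, Finset.sum_sub_distrib, ite_div]
  rw [hsum] at hle
  linarith

/-- The expected squared Hellinger distance (up to a factor) of the choice models with values `v`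
and `v'` under assortments drawn from `q`. -/
def hellingerLoss (q : Assortment N K → ℝ) (v v' : Cube N) : ℝ :=
  ∑ S, q S * (1 - affinity S.1 v v')

theorem hellingerLoss_mem_Icc {q : Assortment N K → ℝ} (hq : q ∈ stdSimplex ℝ (Assortment N K))
    (v v' : Cube N) : hellingerLoss q v v' ∈ Set.Icc (0 : ℝ) 1 := by
  refine ⟨Finset.sum_nonneg fun S _ =>
    mul_nonneg (hq.1 S) (sub_nonneg.2 (affinity_le_one _ _ _)), ?_⟩
  rw [← hq.2]
  exact Finset.sum_le_sum fun S _ =>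
    mul_le_of_le_one_right (hq.1 S) (by linarith [affinity_nonneg S.1 v v'])

/-- Exchanging sums over items and assortments turns the left side into an average over `S ∼ q`, to
which `sum_sq_value_sub_le` applies. -/
theorem sum_itemProb_mul_sq_le {q : Assortment N K → ℝ} (hq : ∀ S, 0 ≤ q S) (v v' : Cube N) :
    ∑ i, itemProb q i * ((v i : ℝ) - v' i) ^ 2 ≤
      16 * ((K : ℝ) + 1) ^ 4 * hellingerLoss q v v' := by
  have h : ∑ i, itemProb q i * ((v i : ℝ) - v' i) ^ 2 =
      ∑ S : Assortment N K, q S * ∑ i ∈ S.1, ((v i : ℝ) - v' i) ^ 2 := by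
    simp only [itemProb, Finset.sum_mul]
    rw [Finset.sum_comm]
    refine Finset.sum_congr rfl fun S _ => ?_
    simp only [ite_mul, zero_mul, Finset.sum_ite_mem, Finset.univ_inter, Finset.mul_sum]
  rw [h, hellingerLoss, Finset.mul_sum]
  refine Finset.sum_le_sum fun S _ => ?_
  calc _ ≤ q S * (16 * ((K : ℝ) + 1) ^ 4 * (1 - affinity S.1 v v')) :=
        mul_le_mul_of_nonneg_left (sum_sq_value_sub_le S.1 S.2.2 v v') (hq S)
    _ = _ := by ring

/-- The loss of the assortment `S` against the best assortment. -/
def rewardGap (K : ℕ) (S : Finset (Fin N)) (v r : Cube N) : ℝ :=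
  (⨆ S : Assortment N K, expReward S.1 v r) - expReward S v r

theorem expReward_le_iSup (S : Assortment N K) (v r : Cube N) :
    expReward S.1 v r ≤ ⨆ S : Assortment N K, expReward S.1 v r :=
  le_ciSup (f := fun S : Assortment N K => expReward S.1 v r) (Set.finite_range _).bddAbove S

theorem rewardGap_nonneg (S : Assortment N K) (v r : Cube N) : 0 ≤ rewardGap K S.1 v r :=
  sub_nonneg.2 (expReward_le_iSup S v r)

theorem rewardGap_le_one (S : Finset (Fin N)) (v r : Cube N) : rewardGap K S v r ≤ 1 := by
  have h1 : (⨆ S : Assortment N K, expReward S.1 v r) ≤ 1 :=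
    Real.iSup_le (fun S => (expReward_mem_Icc _ _ _).2) zero_le_one
  have := (expReward_mem_Icc S v r).1
  rw [rewardGap]; linarith

theorem exists_rewardGap_eq_zero [Nonempty (Assortment N K)] (v r : Cube N) :
    ∃ S : Assortment N K, rewardGap K S.1 v r = 0 := by
  obtain ⟨S, hS⟩ := exists_eq_ciSup_of_finite (f := fun S : Assortment N K => expReward S.1 v r)
  exact ⟨S, by rw [rewardGap, ← hS, sub_self]⟩

/-- Optimality towards the best assortment, with the nonnegative coverage term dropped. -/
theorem IsBarrierArgmax.sum_mul_rewardGap_le [Nonempty (Assortment N K)] {γ : ℝ} (hγ : 0 < γ)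
    {v r : Cube N} {ρ : Assortment N K → ℝ} (h : IsBarrierArgmax γ v r ρ) :
    ∑ S, ρ S * rewardGap K S.1 v r ≤ ((K : ℝ) + 1) ^ 4 / γ * N := by
  obtain ⟨S, hS⟩ := exists_rewardGap_eq_zero (K := K) v r
  have h1 := h.expReward_add_le hγ S
  have h2 : 0 ≤ ((K : ℝ) + 1) ^ 4 / γ * ∑ i ∈ S.1, 1 / itemProb ρ i :=
    mul_nonneg (by positivity) (Finset.sum_nonneg fun i _ => (one_div_pos.2 (h.1.2 i)).le)
  simp only [rewardGap, mul_sub, Finset.sum_sub_distrib, ← Finset.sum_mul, h.1.1.2] at hS ⊢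
  linarith

/-- A predictor with small Hellinger loss under the barrier policy for the values `u` predicts the
rewards of all assortments, up to a fraction of the loss they have for the values `u`. -/
theorem IsBarrierArgmax.abs_expReward_sub_le {γ : ℝ} (hγ : 0 < γ) {u r : Cube N}
    {q : Assortment N K → ℝ} (h : IsBarrierArgmax γ u r q) (v v' : Cube N) (S : Assortment N K) :
    |expReward S.1 v r - expReward S.1 v' r| ≤ ((K : ℝ) + 1) ^ 4 / γ * N / 8 +
      rewardGap K S.1 u r / 8 + 32 * γ * hellingerLoss q v v' := by
  have h1 := h.expReward_add_le hγ S
  have h2 : ∑ S', q S' * expReward S'.1 u r ≤ ⨆ S : Assortment N K, expReward S.1 u r := by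
    calc _ ≤ ∑ S', q S' * ⨆ S : Assortment N K, expReward S.1 u r :=
          Finset.sum_le_sum fun S' _ =>
            mul_le_mul_of_nonneg_left (expReward_le_iSup S' u r) (h.1.1.1 S')
      _ = _ := by rw [← Finset.sum_mul, h.1.1.2, one_mul]
  have h3 := sum_itemProb_mul_sq_le h.1.1.1 v v'
  set Λ : ℝ := ((K : ℝ) + 1) ^ 4 / γ with hΛ
  have hΛ0 : 0 < Λ := by positivity
  -- AM-GM item by item, `a ≤ Λ / (8 w) + 2 w a^2 / Λ`; the `1/8` is what leaves only an eighth of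
  -- the gap after inserting the coverage bound.
  have h4 : ∑ i ∈ S.1, |(v i : ℝ) - v' i| ≤
      Λ / 8 * ∑ i ∈ S.1, 1 / itemProb q i + 2 / Λ * ∑ i, itemProb q i * ((v i : ℝ) - v' i) ^ 2 := by
    have h5 : ∑ i ∈ S.1, itemProb q i * ((v i : ℝ) - v' i) ^ 2 ≤
        ∑ i, itemProb q i * ((v i : ℝ) - v' i) ^ 2 :=
      Finset.sum_le_sum_of_subset_of_nonneg (Finset.subset_univ _)
        fun i _ _ => mul_nonneg (h.1.2 i).le (sq_nonneg _)
    refine le_trans ?_ (add_le_add_right (mul_le_mul_of_nonneg_left h5 (by positivity)) _)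
    rw [Finset.mul_sum, Finset.mul_sum, ← Finset.sum_add_distrib]
    refine Finset.sum_le_sum fun i _ => ?_
    have hw := h.1.2 i
    rw [← sq_abs ((v i : ℝ) - v' i)]
    generalize |(v i : ℝ) - v' i| = a
    generalize itemProb q i = w at hw
    have h6 : Λ / 8 * (1 / w) + 2 / Λ * (w * a ^ 2) - a =
        (Λ - 4 * w * a) ^ 2 / (8 * Λ * w) := by
      field_simp
      ring
    have : 0 ≤ (Λ - 4 * w * a) ^ 2 / (8 * Λ * w) := by positivity
    linarith
  -- The weight `(K+1)^4` of the barrier cancels against the constant of the Hellinger comparison.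
  have h7 : 2 / Λ * ∑ i, itemProb q i * ((v i : ℝ) - v' i) ^ 2 ≤
      32 * γ * hellingerLoss q v v' := by
    calc _ ≤ 2 / Λ * (16 * ((K : ℝ) + 1) ^ 4 * hellingerLoss q v v') := by gcongr
      _ = _ := by rw [hΛ]; field_simp; ring
  refine (MNLBandit.abs_expReward_sub_le S.1 v v' r).trans (h4.trans ?_)
  rw [rewardGap]
  linarith

/-- One step of the comparison between predicted and true losses: from the values `u` of an epoch to
the values `v` of the next epoch, where `w` are the true values. -/
theorem rewardGap_comparison [Nonempty (Assortment N K)] {u v w r : Cube N} {b φ : ℝ}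
    (hb : ∀ S : Assortment N K,
      |expReward S.1 v r - expReward S.1 w r| ≤ b + rewardGap K S.1 u r / 8)
    (hu : ∀ S : Assortment N K, rewardGap K S.1 u r ≤ 2 * rewardGap K S.1 w r + φ)
    (S : Assortment N K) :
    rewardGap K S.1 v r ≤ 2 * rewardGap K S.1 w r + 8 / 3 * (b + φ / 8) ∧
      rewardGap K S.1 w r ≤ 2 * rewardGap K S.1 v r + 8 / 3 * (b + φ / 8) := by
  obtain ⟨V, hV⟩ := exists_rewardGap_eq_zero (K := K) v r
  obtain ⟨W, hW⟩ := exists_rewardGap_eq_zero (K := K) w r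
  have a1 := abs_le.1 (hb S)
  have a2 := abs_le.1 (hb V)
  have a3 := abs_le.1 (hb W)
  have b1 := hu S
  have b2 := hu V
  have b3 := hu W
  have c1 := rewardGap_nonneg S v r
  have c2 := rewardGap_nonneg S w r
  have c3 := rewardGap_nonneg V w r
  have c4 := rewardGap_nonneg W v r
  have e1 : rewardGap K S.1 v r = expReward V.1 v r - expReward S.1 v r := by
    rw [rewardGap] at *; linarith
  have e2 : rewardGap K S.1 w r = expReward W.1 w r - expReward S.1 w r := by
    simp only [rewardGap] at *; linarith
  have e3 : rewardGap K V.1 w r = expReward W.1 w r - expReward V.1 w r := by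
    simp only [rewardGap] at *; linarith
  have e4 : rewardGap K W.1 v r = expReward V.1 v r - expReward W.1 v r := by
    simp only [rewardGap] at *; linarith
  -- Write `c = b + φ / 8`. Comparing `V` and `W` gives `(3/4) gap_w(V) ≤ 2c`, that is `gap_w(V) ≤
  -- (8/3) c`. Then `gap_v(S) ≤ (5/4) gap_w(S) + 2c + gap_w(V) / 4`, and comparing `S` with `W`
  -- gives `(3/4) gap_w(S) ≤ gap_v(S) + 2c`; both yield `(8/3) c`.
  constructor <;> linarith

end

/-! ### The law of the run and the decomposition of the regret into rounds -/

section

section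

variable {X : Type*} {N K : ℕ}

/-- The first `s` entries of a sequence of length `t`. -/
def restr {α : Type*} {s t : ℕ} (hst : s ≤ t) (h : Fin t → α) : Fin s → α :=
  fun k => h (Fin.castLE hst k)

theorem restr_snoc {α : Type*} {s t : ℕ} (hst : s ≤ t) (h : Fin t → α) (o : α) :
    restr (hst.trans t.le_succ) (Fin.snoc (α := fun _ => α) h o) = restr hst h := by
  funext k
  exact Fin.snoc_castSucc (α := fun _ => α) o h (Fin.castLE hst k)

/-- The data of the rounds `τ (m - 1) + 1, …, τ m`, read off from the first `τ m` rounds. -/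
def prevData (m : ℕ) (h : Fin (τ m) → Round X N K) : EpochData X N K m :=
  fun k =>
    let o := h ⟨τ (m - 1) + k, by have := k.2; omega⟩
    (o.1, o.2.2)

theorem epochData_eq {t : ℕ} (h : Fin t → Round X N K) :
    epochData h = prevData (epochOf t) (restr (τ_epochOf_le t) h) := rfl

theorem epochOf_eq {m t : ℕ} (hm : 1 ≤ m) (h1 : τ m ≤ t) (h2 : t < τ (m + 1)) : epochOf t = m := by
  obtain ⟨m, rfl⟩ := Nat.exists_eq_add_of_le' hm
  simp only [τ, Nat.add_sub_cancel] at h1 h2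
  have : Nat.log 2 (t + 1) = m := Nat.log_eq_of_pow_le_of_lt_pow (by omega) (by omega)
  rw [epochOf, this]

theorem totalGap_snoc (fstar : X → Cube N) {t : ℕ} (h : Fin t → Round X N K) (o : Round X N K) :
    totalGap fstar (Fin.snoc (α := fun _ => Round X N K) h o : Fin (t + 1) → Round X N K) =
      totalGap fstar h + rewardGap K o.2.2.1.1 (fstar o.1) o.2.1 := by
  simp only [totalGap, rewardGap, Fin.sum_univ_castSucc, Fin.snoc_castSucc, Fin.snoc_last]
  ring

end

variable {X : Type*} [MeasurableSpace X] {N K : ℕ} {F : Set (X → Cube N)} {γ : ℕ → ℝ}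

@[fun_prop]
theorem measurable_restr {α : Type*} [MeasurableSpace α] {s t : ℕ} (hst : s ≤ t) :
    Measurable (restr hst : (Fin t → α) → Fin s → α) := by
  unfold restr
  fun_prop

@[fun_prop]
theorem measurable_prevData (m : ℕ) :
    Measurable (prevData m : (Fin (τ m) → Round X N K) → EpochData X N K m) := by
  unfold prevData
  fun_prop

/-- The policy of epoch `m`, given the rounds before this epoch. -/
def epochPolicy (A : BarrierERMAlgorithm K F γ) (m : ℕ) (h : Fin (τ m) → Round X N K) (x : X)
    (r : Cube N) : Assortment N K → ℝ :=
  A.policy m (prevData m h) x r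

/-- The predictor of epoch `m`, given the rounds before this epoch. -/
def epochPredictor (A : BarrierERMAlgorithm K F γ) (m : ℕ) (h : Fin (τ m) → Round X N K) (x : X) :
    Cube N :=
  A.predictor m (prevData m h) x

theorem policy_epochData_eq (A : BarrierERMAlgorithm K F γ) {m t : ℕ} (hm : 1 ≤ m) (h1 : τ m ≤ t)
    (h2 : t < τ (m + 1)) (h : Fin t → Round X N K) :
    A.policy (epochOf t) (epochData h) = epochPolicy A m (restr h1 h) := by
  obtain rfl := epochOf_eq hm h1 h2
  rfl

theorem isBarrierArgmax_epochPolicy (A : BarrierERMAlgorithm K F γ) (m : ℕ)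
    (h : Fin (τ m) → Round X N K) (x : X) (r : Cube N) :
    IsBarrierArgmax (γ m) (epochPredictor A m h x) r (epochPolicy A m h x r) :=
  A.isBarrierArgmax m _ x r

theorem epochPolicy_mem (A : BarrierERMAlgorithm K F γ) (m : ℕ)
    (h : Fin (τ m) → Round X N K) (x : X) (r : Cube N) :
    epochPolicy A m h x r ∈ stdSimplex ℝ (Assortment N K) :=
  (isBarrierArgmax_epochPolicy A m h x r).1.1

@[fun_prop]
theorem Measurable.epochPolicy (A : BarrierERMAlgorithm K F γ) (m : ℕ) {Y : Type*}
    [MeasurableSpace Y] {h : Y → Fin (τ m) → Round X N K} {x : Y → X} {r : Y → Cube N}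
    (hh : Measurable h) (hx : Measurable x) (hr : Measurable r) (S : Assortment N K) :
    Measurable fun y => epochPolicy A m (h y) (x y) (r y) S :=
  (measurable_pi_apply S).comp ((A.measurable_policy m).comp
    (((measurable_prevData m).comp hh).prodMk (hx.prodMk hr)))

@[fun_prop]
theorem Measurable.epochPredictor (A : BarrierERMAlgorithm K F γ) (m : ℕ) {Y : Type*}
    [MeasurableSpace Y] {h : Y → Fin (τ m) → Round X N K} {x : Y → X}
    (hh : Measurable h) (hx : Measurable x) :
    Measurable fun y => epochPredictor A m (h y) (x y) :=
  (A.measurable_predictor m).comp (((measurable_prevData m).comp hh).prodMk hx)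

theorem Measurable.affinity {Y : Type*} [MeasurableSpace Y] (S : Finset (Fin N))
    {u v : Y → Cube N} (hu : Measurable u) (hv : Measurable v) :
    Measurable fun y => affinity S (u y) (v y) :=
  Finset.measurable_sum _ fun i _ =>
    ((measurable_choiceProb S i hu).mul (measurable_choiceProb S i hv)).sqrt

theorem Measurable.hellingerLoss {Y : Type*} [MeasurableSpace Y] {q : Y → Assortment N K → ℝ}
    {u v : Y → Cube N} (hq : ∀ S, Measurable fun y => q y S) (hu : Measurable u)
    (hv : Measurable v) : Measurable fun y => hellingerLoss (q y) (u y) (v y) :=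
  Finset.measurable_sum _ fun S _ =>
    (hq S).mul (measurable_const.sub (Measurable.affinity S.1 hu hv))

theorem Measurable.rewardGap {Y : Type*} [MeasurableSpace Y] (S : Finset (Fin N))
    {v r : Y → Cube N} (hv : Measurable v) (hr : Measurable r) :
    Measurable fun y => rewardGap K S (v y) (r y) :=
  (Measurable.iSup fun S : Assortment N K => measurable_expReward S.1 hv hr).sub
    (measurable_expReward S hv hr)

theorem integrable_of_mem_Icc {Y : Type*} [MeasurableSpace Y] {P : Measure Y} [IsFiniteMeasure P]
    {f : Y → ℝ} (hf : Measurable f) (h : ∀ y, f y ∈ Set.Icc (0 : ℝ) 1) : Integrable f P :=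
  Integrable.of_bound hf.aestronglyMeasurable 1 (Filter.Eventually.of_forall fun y => by
    rw [Real.norm_eq_abs, abs_of_nonneg (h y).1]; exact (h y).2)

theorem lintegral_stepLaw (A : BarrierERMAlgorithm K F γ) (fstar : X → Cube N) (t : ℕ)
    (p : (Fin t → Round X N K) × X × Cube N) {G : (Fin (t + 1) → Round X N K) → ENNReal}
    (hG : Measurable G) :
    ∫⁻ h, G h ∂(stepLaw A fstar t p) = ∑ S : Assortment N K, ∑ i : Fin (N + 1),
      ENNReal.ofReal (A.policy (epochOf t) (epochData p.1) p.2.1 p.2.2 S *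
        choiceProb S.1 (fstar p.2.1) i) *
          G (Fin.snoc (α := fun _ => Round X N K) p.1 (p.2.1, p.2.2, S, i)) := by
  simp only [stepLaw, lintegral_finsetSum_measure, lintegral_smul_measure, smul_eq_mul,
    lintegral_dirac' _ hG]

theorem integral_stepLaw (A : BarrierERMAlgorithm K F γ) (fstar : X → Cube N) (t : ℕ)
    (p : (Fin t → Round X N K) × X × Cube N) {G : (Fin (t + 1) → Round X N K) → ℝ}
    (hG : Measurable G) :
    ∫ h, G h ∂(stepLaw A fstar t p) = ∑ S : Assortment N K, ∑ i : Fin (N + 1),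
      A.policy (epochOf t) (epochData p.1) p.2.1 p.2.2 S * choiceProb S.1 (fstar p.2.1) i *
          G (Fin.snoc (α := fun _ => Round X N K) p.1 (p.2.1, p.2.2, S, i)) := by
  have hq : ∀ S, 0 ≤ A.policy (epochOf t) (epochData p.1) p.2.1 p.2.2 S :=
    (A.isBarrierArgmax (epochOf t) (epochData p.1) p.2.1 p.2.2).1.1.1
  have hI : ∀ S i, Integrable G (ENNReal.ofReal
      (A.policy (epochOf t) (epochData p.1) p.2.1 p.2.2 S * choiceProb S.1 (fstar p.2.1) i) •
        Measure.dirac (Fin.snoc (α := fun _ => Round X N K) p.1 (p.2.1, p.2.2, S, i))) :=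
    fun S i => (integrable_dirac' hG.stronglyMeasurable (by simp)).smul_measure
      ENNReal.ofReal_ne_top
  rw [stepLaw, integral_finsetSum_measure fun S _ => integrable_finsetSum_measure.2 fun i _ => hI S i]
  refine Finset.sum_congr rfl fun S _ => ?_
  rw [integral_finsetSum_measure fun i _ => hI S i]
  refine Finset.sum_congr rfl fun i _ => ?_
  rw [integral_smul_measure, integral_dirac' _ _ hG.stronglyMeasurable,
    ENNReal.toReal_ofReal (mul_nonneg (hq S) (choiceProb_nonneg _ _ _)), smul_eq_mul]

/-- A step only appends a round, and its conditional law has mass one, so forgetting the last round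
undoes it. -/
theorem map_restr_runLaw_succ (𝒟 : Measure (X × Cube N)) [IsProbabilityMeasure 𝒟]
    (A : BarrierERMAlgorithm K F γ) {fstar : X → Cube N} (hf : Measurable fstar) (t : ℕ) :
    (runLaw 𝒟 A fstar (t + 1)).map (restr t.le_succ) = runLaw 𝒟 A fstar t := by
  have := isProbabilityMeasure_runLaw 𝒟 A hf t
  refine Measure.ext_of_lintegral _ fun G hG => ?_
  rw [lintegral_map hG (measurable_restr _), runLaw,
    Measure.lintegral_bind (measurable_stepLaw A hf t).aemeasurable (by fun_prop)]
  have h : ∀ p, ∫⁻ h, G (restr t.le_succ h) ∂(stepLaw A fstar t p) = G p.1 := by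
    intro p
    have := isProbabilityMeasure_stepLaw A fstar t p
    have h1 : ∀ S i, G (restr t.le_succ (Fin.snoc (α := fun _ => Round X N K) p.1
        (p.2.1, p.2.2, S, i))) = G p.1 := fun S i => congrArg G (restr_snoc le_rfl _ _)
    rw [lintegral_stepLaw A fstar t p (by fun_prop)]
    simp only [h1]
    rw [← lintegral_stepLaw A fstar t p (G := fun _ => G p.1) measurable_const]
    simp
  simp only [h]
  rw [lintegral_prod _ (by fun_prop)]
  simp

theorem measurePreserving_restr (𝒟 : Measure (X × Cube N)) [IsProbabilityMeasure 𝒟]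
    (A : BarrierERMAlgorithm K F γ) {fstar : X → Cube N} (hf : Measurable fstar) {s t : ℕ}
    (hst : s ≤ t) :
    MeasurePreserving (restr hst) (runLaw 𝒟 A fstar t) (runLaw 𝒟 A fstar s) := by
  induction t, hst using Nat.le_induction with
  | base => exact MeasurePreserving.id _
  | succ t hst ih => exact ih.comp ⟨measurable_restr _, map_restr_runLaw_succ 𝒟 A hf t⟩

theorem measurable_totalGap {fstar : X → Cube N} (hf : Measurable fstar) (t : ℕ) :
    Measurable (totalGap fstar : (Fin t → Round X N K) → ℝ) := by
  have hx : ∀ k : Fin t, Measurable fun h : Fin t → Round X N K => fstar (h k).1 := fun k => by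
    fun_prop
  refine (Finset.measurable_sum _ fun k _ => Measurable.iSup fun S =>
    measurable_expReward S.1 (hx k) (by fun_prop)).sub (Finset.measurable_sum _ fun k _ => ?_)
  have h1 : ∀ S : Assortment N K, Measurable fun h : Fin t → Round X N K =>
      if (h k).2.2.1 = S then expReward S.1 (fstar (h k).1) (h k).2.1 else 0 := fun S =>
    Measurable.ite (measurableSet_eq_fun (by fun_prop) measurable_const)
      (measurable_expReward S.1 (hx k) (by fun_prop)) measurable_const
  have h2 := Finset.measurable_sum (Finset.univ : Finset (Assortment N K)) fun S _ => h1 S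
  simpa only [Finset.sum_ite_eq, Finset.mem_univ, if_true] using h2

/-- The expected loss of the policy of round `t + 1`, given the first `t` rounds and the context and
rewards of this round. -/
def policyGap (A : BarrierERMAlgorithm K F γ) (fstar : X → Cube N) (t : ℕ)
    (p : (Fin t → Round X N K) × X × Cube N) : ℝ :=
  ∑ S, A.policy (epochOf t) (epochData p.1) p.2.1 p.2.2 S * rewardGap K S.1 (fstar p.2.1) p.2.2

theorem policyGap_mem_Icc (A : BarrierERMAlgorithm K F γ) (fstar : X → Cube N) (t : ℕ)
    (p : (Fin t → Round X N K) × X × Cube N) : policyGap A fstar t p ∈ Set.Icc (0 : ℝ) 1 := by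
  have hq := (A.isBarrierArgmax (epochOf t) (epochData p.1) p.2.1 p.2.2).1.1
  refine ⟨Finset.sum_nonneg fun S _ => mul_nonneg (hq.1 S) (rewardGap_nonneg _ _ _), ?_⟩
  rw [← hq.2]
  exact Finset.sum_le_sum fun S _ => mul_le_of_le_one_right (hq.1 S) (rewardGap_le_one _ _ _)

theorem measurable_policyGap (A : BarrierERMAlgorithm K F γ) {fstar : X → Cube N}
    (hf : Measurable fstar) (t : ℕ) : Measurable (policyGap A fstar t) := by
  refine Finset.measurable_sum _ fun S _ => Measurable.mul ?_
    (Measurable.rewardGap _ (by fun_prop) (by fun_prop))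
  simp only [epochData_eq]
  exact Measurable.epochPolicy A _ (by fun_prop) (by fun_prop) (by fun_prop) S

theorem regret_zero (𝒟 : Measure (X × Cube N)) (A : BarrierERMAlgorithm K F γ)
    (fstar : X → Cube N) : regret 𝒟 A fstar 0 = 0 := by
  simp [regret, totalGap]

/-- The tower property: conditionally on the past, the context and the rewards, the new gap averages
to `policyGap`, the purchase being irrelevant. -/
theorem regret_succ (𝒟 : Measure (X × Cube N)) [IsProbabilityMeasure 𝒟]
    (A : BarrierERMAlgorithm K F γ) {fstar : X → Cube N} (hf : Measurable fstar) (t : ℕ) :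
    regret 𝒟 A fstar (t + 1) = regret 𝒟 A fstar t +
      ∫ p, policyGap A fstar t p ∂((runLaw 𝒟 A fstar t).prod 𝒟) := by
  have := isProbabilityMeasure_runLaw 𝒟 A hf t
  have hI := integrable_totalGap 𝒟 A hf (t + 1)
  have h : ∀ p, ∫ h, totalGap fstar h ∂(stepLaw A fstar t p) =
      totalGap fstar p.1 + policyGap A fstar t p := by
    intro p
    have hq := (A.isBarrierArgmax (epochOf t) (epochData p.1) p.2.1 p.2.2).1.1
    rw [integral_stepLaw A fstar t p (measurable_totalGap hf _)]
    simp only [totalGap_snoc, ← Finset.sum_mul, ← Finset.mul_sum, sum_choiceProb, mul_one, mul_add,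
      Finset.sum_add_distrib, hq.2, one_mul]
    rfl
  -- Viewing the step as a kernel makes Fubini for composed kernels available for the Bochner
  -- integral.
  let κ : ProbabilityTheory.Kernel ((Fin t → Round X N K) × X × Cube N)
    (Fin (t + 1) → Round X N K) := ⟨stepLaw A fstar t, measurable_stepLaw A hf t⟩
  have hκ : runLaw 𝒟 A fstar (t + 1) = ((runLaw 𝒟 A fstar t).prod 𝒟).bind κ := rfl
  rw [hκ, Measure.comp_eq_comp_const_apply] at hI
  rw [regret, hκ, Measure.comp_eq_comp_const_apply, ProbabilityTheory.Kernel.integral_comp hI,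
    ProbabilityTheory.Kernel.const_apply]
  change ∫ p, ∫ h, totalGap fstar h ∂(stepLaw A fstar t p) ∂_ = _
  simp only [h]
  rw [integral_add, integral_fun_fst]
  · simp [regret]
  · exact (integrable_totalGap 𝒟 A hf t).comp_fst _
  · exact integrable_of_mem_Icc (measurable_policyGap A hf t) (policyGap_mem_Icc A fstar t)

theorem regret_eq_sum (𝒟 : Measure (X × Cube N)) [IsProbabilityMeasure 𝒟]
    (A : BarrierERMAlgorithm K F γ) {fstar : X → Cube N} (hf : Measurable fstar) (T : ℕ) :
    regret 𝒟 A fstar T =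
      ∑ t ∈ Finset.range T, ∫ p, policyGap A fstar t p ∂((runLaw 𝒟 A fstar t).prod 𝒟) := by
  induction T with
  | zero => simp [regret_zero]
  | succ T ih => rw [regret_succ 𝒟 A hf, ih, Finset.sum_range_succ]

theorem regret_le_card (𝒟 : Measure (X × Cube N)) [IsProbabilityMeasure 𝒟]
    (A : BarrierERMAlgorithm K F γ) {fstar : X → Cube N} (hf : Measurable fstar) (T : ℕ) :
    regret 𝒟 A fstar T ≤ T := by
  rw [regret_eq_sum 𝒟 A hf]
  refine (Finset.sum_le_sum fun t _ => ?_ : _ ≤ ∑ t ∈ Finset.range T, (1 : ℝ)).trans (by simp)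
  have := isProbabilityMeasure_runLaw 𝒟 A hf t
  calc ∫ p, policyGap A fstar t p ∂((runLaw 𝒟 A fstar t).prod 𝒟)
      ≤ ∫ _, (1 : ℝ) ∂((runLaw 𝒟 A fstar t).prod 𝒟) :=
        integral_mono (integrable_of_mem_Icc (measurable_policyGap A hf t)
          (policyGap_mem_Icc A fstar t)) (integrable_const _)
          fun p => (policyGap_mem_Icc A fstar t p).2
    _ = 1 := by simp

end

/-! ### Hellinger loss of the maximum likelihood estimator -/

section

section

variable {N K : ℕ}

/-- The entries of `v` and `v'` agree up to a factor `exp ε`. -/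
def LogClose (ε : ℝ) (v v' : Cube N) : Prop :=
  ∀ i, (v i : ℝ) ≤ Real.exp ε * v' i ∧ (v' i : ℝ) ≤ Real.exp ε * v i

theorem LogClose.symm {ε : ℝ} {v v' : Cube N} (h : LogClose ε v v') : LogClose ε v' v :=
  fun i => (h i).symm

/-- Numerator and denominator each change by a factor at most `exp ε`. -/
theorem LogClose.choiceProb_le {ε : ℝ} (hε : 0 ≤ ε) {v v' : Cube N} (h : LogClose ε v v')
    (S : Finset (Fin N)) (i : Fin (N + 1)) :
    choiceProb S v i ≤ Real.exp (2 * ε) * choiceProb S v' i := by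
  have hV := sum_value_nonneg S v
  have hV' := sum_value_nonneg S v'
  have he : 1 ≤ Real.exp ε := Real.one_le_exp hε
  have h1 : 1 + ∑ j ∈ S, (v' j : ℝ) ≤ Real.exp ε * (1 + ∑ j ∈ S, (v j : ℝ)) := by
    have : ∑ j ∈ S, (v' j : ℝ) ≤ Real.exp ε * ∑ j ∈ S, (v j : ℝ) := by
      rw [Finset.mul_sum]
      exact Finset.sum_le_sum fun j _ => (h j).2
    linarith
  have h2 : Real.exp (2 * ε) = Real.exp ε * Real.exp ε := by rw [two_mul, Real.exp_add]
  refine Fin.cases ?_ (fun i => ?_) i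
  · rw [choiceProb_zero, choiceProb_zero, h2, mul_one_div, div_le_div_iff₀ (by linarith) (by linarith),
      one_mul, mul_assoc]
    exact h1.trans (le_mul_of_one_le_left (by positivity) he)
  · rw [choiceProb_succ, choiceProb_succ]
    split_ifs with hi
    · rw [h2, ← mul_div_assoc, div_le_div_iff₀ (by linarith) (by linarith)]
      calc (v i : ℝ) * (1 + ∑ j ∈ S, (v' j : ℝ))
          ≤ (Real.exp ε * v' i) * (Real.exp ε * (1 + ∑ j ∈ S, (v j : ℝ))) :=
            mul_le_mul (h i).1 h1 (by linarith) (mul_nonneg (by linarith) (v' i).2.1)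
        _ = _ := by ring
    · simp

theorem choiceProb_pos {v : Cube N} (hv : ∀ i, 0 < (v i : ℝ)) {S : Finset (Fin N)}
    {i : Fin (N + 1)} (hi : ∀ j, i = Fin.succ j → j ∈ S) : 0 < choiceProb S v i := by
  have hV := sum_value_nonneg S v
  revert hi
  refine Fin.cases (fun _ => ?_) (fun i hi => ?_) i
  · rw [choiceProb_zero]; positivity
  · rw [choiceProb_succ, if_pos (hi i rfl)]
    have := hv i
    positivity

theorem choiceProb_eq_zero (v : Cube N) {S : Finset (Fin N)}
    {i : Fin (N + 1)} (hi : ¬ ∀ j, i = Fin.succ j → j ∈ S) : choiceProb S v i = 0 := by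
  push Not at hi
  obtain ⟨j, rfl, hj⟩ := hi
  rw [choiceProb_succ, if_neg hj]

theorem LogClose.logLoss_le {ε : ℝ} (hε : 0 ≤ ε) {v v' : Cube N} (h : LogClose ε v v')
    (hv : ∀ i, 0 < (v i : ℝ)) (hv' : ∀ i, 0 < (v' i : ℝ)) (S : Finset (Fin N))
    (i : Fin (N + 1)) : logLoss S v' i ≤ logLoss S v i + 2 * ε := by
  by_cases hi : ∀ j, i = Fin.succ j → j ∈ S
  · have h1 := Real.log_le_log (choiceProb_pos hv hi) (h.choiceProb_le hε S i)
    rw [Real.log_mul (Real.exp_pos _).ne' (choiceProb_pos hv' hi).ne', Real.log_exp] at h1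
    rw [logLoss, logLoss]
    linarith
  -- Items outside `S` have probability zero under both models, so both losses take the same default
  -- value `-Real.log 0 = 0`.
  · rw [logLoss, logLoss, choiceProb_eq_zero v hi, choiceProb_eq_zero v' hi]
    linarith

/-- The square root halves the exponent `2 ε`; the factor `exp ε` becomes an additive `ε` because `1
- exp (-ε) ≤ ε` and the affinity is at most 1. -/
theorem LogClose.affinity_le {ε : ℝ} (hε : 0 ≤ ε) {v v' : Cube N} (h : LogClose ε v v')
    (w : Cube N) (S : Finset (Fin N)) : affinity S v w ≤ affinity S v' w + ε := by
  have h1 : affinity S v w ≤ Real.exp ε * affinity S v' w := by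
    rw [affinity, affinity, Finset.mul_sum]
    refine Finset.sum_le_sum fun i _ => ?_
    refine Real.sqrt_le_iff.2 ⟨by positivity, ?_⟩
    rw [mul_pow, Real.sq_sqrt (mul_nonneg (choiceProb_nonneg _ _ _) (choiceProb_nonneg _ _ _)),
      ← mul_assoc, ← Real.exp_nat_mul]
    exact mul_le_mul_of_nonneg_right (h.choiceProb_le hε S i) (choiceProb_nonneg _ _ _)
  have h2 : Real.exp (-ε) * affinity S v w ≤ affinity S v' w := by
    rw [Real.exp_neg, inv_mul_le_iff₀ (Real.exp_pos ε)]
    exact h1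
  have h3 := Real.one_sub_le_exp_neg ε
  have h4 := affinity_le_one S v w
  have h5 := affinity_nonneg S v w
  nlinarith

theorem LogClose.hellingerLoss_le {ε : ℝ} (hε : 0 ≤ ε) {v v' : Cube N} (h : LogClose ε v v')
    (w : Cube N) {q : Assortment N K → ℝ} (hq : q ∈ stdSimplex ℝ (Assortment N K)) :
    hellingerLoss q v w ≤ hellingerLoss q v' w + ε := by
  have h1 : hellingerLoss q v' w + ε = ∑ S, q S * (1 - affinity S.1 v' w + ε) := by
    simp only [hellingerLoss, mul_add, Finset.sum_add_distrib, ← Finset.sum_mul, hq.2, one_mul]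
  rw [h1]
  refine Finset.sum_le_sum fun S _ => mul_le_mul_of_nonneg_left ?_ (hq.1 S)
  have := h.symm.affinity_le hε w S.1
  linarith

/-- The exponential is the square root of the likelihood ratio of `v` to the truth `w`, and `w √(v /
w) = √(v w)`. -/
theorem sum_choiceProb_mul_exp {v w : Cube N} (hv : ∀ i, 0 < (v i : ℝ)) (hw : ∀ i, 0 < (w i : ℝ))
    (S : Finset (Fin N)) :
    ∑ i, choiceProb S w i * Real.exp ((logLoss S w i - logLoss S v i) / 2) = affinity S v w := by
  refine Finset.sum_congr rfl fun i _ => ?_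
  by_cases hi : ∀ j, i = Fin.succ j → j ∈ S
  · have h1 := choiceProb_pos hv hi
    have h2 := choiceProb_pos hw hi
    rw [logLoss, logLoss, Real.sqrt_eq_rpow, Real.rpow_def_of_pos (mul_pos h1 h2),
      Real.log_mul h1.ne' h2.ne']
    nth_rewrite 1 [← Real.exp_log h2]
    rw [← Real.exp_add]
    congr 1
    ring
  · rw [choiceProb_eq_zero v hi, choiceProb_eq_zero w hi]
    simp

end

variable {X : Type*} [MeasurableSpace X] {N K : ℕ} {F : Set (X → Cube N)} {γ : ℕ → ℝ}

theorem measurable_logLoss {Y : Type*} [MeasurableSpace Y] {v : Y → Cube N}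
    {S : Y → Assortment N K} {i : Y → Fin (N + 1)} (hv : Measurable v) (hS : Measurable S)
    (hi : Measurable i) : Measurable fun y => logLoss (S y).1 (v y) (i y) := by
  have h1 : ∀ (S' : Assortment N K) (i' : Fin (N + 1)), Measurable fun y =>
      if S y = S' then if i y = i' then logLoss S'.1 (v y) i' else 0 else 0 := fun S' i' =>
    Measurable.ite (measurableSet_eq_fun hS measurable_const)
      (Measurable.ite (measurableSet_eq_fun hi measurable_const)
        (measurable_choiceProb S'.1 i' hv).log.neg measurable_const) measurable_const
  have h2 := Finset.measurable_sum (Finset.univ : Finset (Assortment N K)) fun S' _ =>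
    Finset.measurable_sum (Finset.univ : Finset (Fin (N + 1))) fun i' _ => h1 S' i'
  simpa using h2

/-- The expected Hellinger loss of the values `g` under the policy of epoch `m`. -/
def epochLoss (𝒟 : Measure (X × Cube N)) (A : BarrierERMAlgorithm K F γ) (fstar : X → Cube N)
    (m : ℕ) (h : Fin (τ m) → Round X N K) (g : X → Cube N) : ℝ :=
  ∫ p, hellingerLoss (epochPolicy A m h p.1 p.2) (g p.1) (fstar p.1) ∂𝒟

/-- The log-likelihood ratio of the values `g` and `fstar` on the first `n` rounds of epoch `m`. -/
def logRatio (fstar g : X → Cube N) (m n : ℕ) (h : Fin (τ m + n) → Round X N K) : ℝ :=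
  ∑ k : Fin n, (logLoss (h (Fin.natAdd (τ m) k)).2.2.1.1 (fstar (h (Fin.natAdd (τ m) k)).1)
    (h (Fin.natAdd (τ m) k)).2.2.2 - logLoss (h (Fin.natAdd (τ m) k)).2.2.1.1
      (g (h (Fin.natAdd (τ m) k)).1) (h (Fin.natAdd (τ m) k)).2.2.2)

theorem measurable_logRatio {fstar g : X → Cube N} (hf : Measurable fstar) (hg : Measurable g)
    (m n : ℕ) : Measurable (logRatio (K := K) fstar g m n) :=
  Finset.measurable_sum _ fun k _ =>
    (measurable_logLoss (by fun_prop) (by fun_prop) (by fun_prop)).sub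
      (measurable_logLoss (by fun_prop) (by fun_prop) (by fun_prop))

theorem integrable_hellingerLoss (𝒟 : Measure (X × Cube N)) [IsProbabilityMeasure 𝒟]
    (A : BarrierERMAlgorithm K F γ) {fstar g : X → Cube N} (hf : Measurable fstar)
    (hg : Measurable g) (m : ℕ) (h : Fin (τ m) → Round X N K) :
    Integrable (fun p => hellingerLoss (epochPolicy A m h p.1 p.2) (g p.1) (fstar p.1)) 𝒟 :=
  integrable_of_mem_Icc (Measurable.hellingerLoss (fun S => by fun_prop) (by fun_prop)
    (by fun_prop)) fun p => hellingerLoss_mem_Icc (epochPolicy_mem A m h p.1 p.2) _ _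

theorem measurable_epochLoss (𝒟 : Measure (X × Cube N)) [IsProbabilityMeasure 𝒟]
    (A : BarrierERMAlgorithm K F γ) {fstar g : X → Cube N} (hf : Measurable fstar)
    (hg : Measurable g) (m : ℕ) : Measurable fun h => epochLoss 𝒟 A fstar m h g := by
  refine (StronglyMeasurable.integral_prod_right (f := fun h (p : X × Cube N) =>
    hellingerLoss (epochPolicy A m h p.1 p.2) (g p.1) (fstar p.1)) ?_).measurable
  exact (Measurable.hellingerLoss (fun S => by fun_prop) (by fun_prop)
    (by fun_prop)).stronglyMeasurable

/-- The square root of the likelihood ratio, normalized by the Hellinger loss, is a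
supermartingale during each epoch. -/
theorem lintegral_exp_logRatio_le (𝒟 : Measure (X × Cube N)) [IsProbabilityMeasure 𝒟]
    (A : BarrierERMAlgorithm K F γ) {fstar g : X → Cube N} (hf : Measurable fstar)
    (hg : Measurable g) (hfpos : ∀ x i, 0 < (fstar x i : ℝ)) (hgpos : ∀ x i, 0 < (g x i : ℝ))
    {m : ℕ} (hm : 1 ≤ m) (n : ℕ) (hn : τ m + n ≤ τ (m + 1)) :
    ∫⁻ h, ENNReal.ofReal (Real.exp (logRatio fstar g m n h / 2 +
      n * epochLoss 𝒟 A fstar m (restr (Nat.le_add_right _ _) h) g))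
        ∂(runLaw 𝒟 A fstar (τ m + n)) ≤ 1 := by
  induction n with
  | zero =>
    have := isProbabilityMeasure_runLaw 𝒟 A hf (τ m + 0)
    simp [logRatio]
  | succ n ih =>
    refine le_trans ?_ (ih (by omega))
    have := isProbabilityMeasure_runLaw 𝒟 A hf (τ m + n)
    have hZ := measurable_logRatio (K := K) hf hg m n
    have hZ' := measurable_logRatio (K := K) hf hg m (n + 1)
    have hL := measurable_epochLoss 𝒟 A hf hg m
    let G : (Fin (τ m + n + 1) → Round X N K) → ENNReal := fun h =>
      ENNReal.ofReal (Real.exp (logRatio fstar g m (n + 1) h / 2 + (n + 1 : ℕ) *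
        epochLoss 𝒟 A fstar m (restr (Nat.le_add_right (τ m) (n + 1)) h) g))
    have hG : Measurable G :=
      ((hZ'.div_const 2).add ((hL.comp (measurable_restr _)).const_mul _)).exp.ennreal_ofReal
    change ∫⁻ h, G h ∂(((runLaw 𝒟 A fstar (τ m + n)).prod 𝒟).bind (stepLaw A fstar (τ m + n))) ≤ _
    rw [Measure.lintegral_bind (measurable_stepLaw A hf (τ m + n)).aemeasurable hG.aemeasurable]
    -- Averaging over assortment and purchase turns the new factor into one minus the Hellinger loss
    -- at this context. The compensator `epochLoss` sees only the rounds before the epoch, so it is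
    -- the same in every round of the epoch.
    have hstep : ∀ p : (Fin (τ m + n) → Round X N K) × X × Cube N,
        ∫⁻ h, G h ∂(stepLaw A fstar (τ m + n) p) =
        ENNReal.ofReal (Real.exp (logRatio fstar g m n p.1 / 2 + (n + 1) *
          epochLoss 𝒟 A fstar m (restr (Nat.le_add_right _ _) p.1) g) *
            (1 - hellingerLoss (epochPolicy A m (restr (Nat.le_add_right _ _) p.1) p.2.1 p.2.2)
              (g p.2.1) (fstar p.2.1))) := by
      intro p
      have hq := epochPolicy_mem A m (restr (Nat.le_add_right _ n) p.1) p.2.1 p.2.2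
      rw [lintegral_stepLaw A fstar _ p hG,
        policy_epochData_eq A hm (Nat.le_add_right _ _) (by omega)]
      have h1 : ∀ (S : Assortment N K) (i : Fin (N + 1)), logRatio fstar g m (n + 1)
          (Fin.snoc (α := fun _ => Round X N K) p.1 (p.2.1, p.2.2, S, i)) =
          logRatio fstar g m n p.1 +
            (logLoss S.1 (fstar p.2.1) i - logLoss S.1 (g p.2.1) i) := by
        intro S i
        rw [logRatio, Fin.sum_univ_castSucc]
        congr 1
        · refine Finset.sum_congr rfl fun k _ => ?_
          have : (Fin.snoc (α := fun _ => Round X N K) p.1 (p.2.1, p.2.2, S, i) :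
              Fin (τ m + n + 1) → Round X N K) (Fin.natAdd (τ m) k.castSucc) =
                p.1 (Fin.natAdd (τ m) k) :=
            Fin.snoc_castSucc (α := fun _ => Round X N K) _ _ (Fin.natAdd (τ m) k)
          rw [this]
        · have : (Fin.snoc (α := fun _ => Round X N K) p.1 (p.2.1, p.2.2, S, i) :
              Fin (τ m + n + 1) → Round X N K) (Fin.natAdd (τ m) (Fin.last n)) =
                (p.2.1, p.2.2, S, i) :=
            Fin.snoc_last (α := fun _ => Round X N K) _ _
          rw [this]
      have h2 : ∀ (S : Assortment N K) (i : Fin (N + 1)),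
          G (Fin.snoc (α := fun _ => Round X N K) p.1 (p.2.1, p.2.2, S, i)) =
            ENNReal.ofReal (Real.exp ((logRatio fstar g m n p.1 +
              (logLoss S.1 (fstar p.2.1) i - logLoss S.1 (g p.2.1) i)) / 2 + (n + 1 : ℕ) *
                epochLoss 𝒟 A fstar m (restr (Nat.le_add_right (τ m) n) p.1) g)) := by
        intro S i
        rw [← h1, ← restr_snoc (Nat.le_add_right (τ m) n) p.1 (p.2.1, p.2.2, S, i)]
      set q := epochPolicy A m (restr (Nat.le_add_right _ n) p.1) p.2.1 p.2.2
      set ℓ := epochLoss 𝒟 A fstar m (restr (Nat.le_add_right _ n) p.1) g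
      set Z := logRatio fstar g m n p.1
      have h3 : 1 - hellingerLoss q (g p.2.1) (fstar p.2.1) =
          ∑ S, q S * affinity S.1 (g p.2.1) (fstar p.2.1) := by
        simp only [hellingerLoss, mul_sub, Finset.sum_sub_distrib, mul_one, hq.2, sub_sub_cancel]
      have hq0 := hq.1
      rw [h3, Finset.mul_sum, ENNReal.ofReal_sum_of_nonneg fun S _ =>
        mul_nonneg (Real.exp_pos _).le (mul_nonneg (hq0 S) (affinity_nonneg _ _ _))]
      refine Finset.sum_congr rfl fun S _ => ?_
      rw [← sum_choiceProb_mul_exp (hgpos p.2.1) (hfpos p.2.1), Finset.mul_sum, Finset.mul_sum,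
        ENNReal.ofReal_sum_of_nonneg fun i _ => mul_nonneg (Real.exp_pos _).le
          (mul_nonneg (hq0 S) (mul_nonneg (choiceProb_nonneg _ _ _) (Real.exp_pos _).le))]
      refine Finset.sum_congr rfl fun i _ => ?_
      rw [h2, ← ENNReal.ofReal_mul (mul_nonneg (hq0 S) (choiceProb_nonneg _ _ _))]
      congr 1
      rw [show (Z + (logLoss S.1 (fstar p.2.1) i - logLoss S.1 (g p.2.1) i)) / 2 +
        ((n + 1 : ℕ) : ℝ) * ℓ = (Z / 2 + (n + 1) * ℓ) +
          (logLoss S.1 (fstar p.2.1) i - logLoss S.1 (g p.2.1) i) / 2 by push_cast; ring,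
        Real.exp_add]
      ring
    simp only [hstep]
    rw [lintegral_prod _ (Measurable.aemeasurable ?_)]
    · refine lintegral_mono fun h => ?_
      set ℓ := epochLoss 𝒟 A fstar m (restr (Nat.le_add_right _ n) h) g with hℓ
      set Z := logRatio fstar g m n h
      have hI := integrable_hellingerLoss 𝒟 A hf hg m (restr (Nat.le_add_right _ n) h)
      have hI1 : Integrable (fun p : X × Cube N => Real.exp (Z / 2 + ((n : ℝ) + 1) * ℓ) *
          (1 - hellingerLoss (epochPolicy A m (restr (Nat.le_add_right _ n) h) p.1 p.2) (g p.1)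
            (fstar p.1))) 𝒟 := ((integrable_const 1).sub hI).const_mul _
      refine (ofReal_integral_eq_lintegral_ofReal hI1
        (Filter.Eventually.of_forall fun p => mul_nonneg (Real.exp_pos _).le
          (sub_nonneg.2 (hellingerLoss_mem_Icc (epochPolicy_mem A m _ _ _) _ _).2))).symm.trans_le ?_
      refine ENNReal.ofReal_le_ofReal ?_
      rw [integral_const_mul, integral_sub (integrable_const 1) hI]
      change _ * (_ - ℓ) ≤ _
      rw [integral_const, probReal_univ, one_smul,
        show Z / 2 + ((n : ℝ) + 1) * ℓ = Z / 2 + n * ℓ + ℓ by ring, Real.exp_add _ ℓ, mul_assoc]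
      refine mul_le_of_le_one_right (Real.exp_pos _).le ?_
      -- Averaging over the context has left `1 - ℓ`, which the additional compensator `exp ℓ`
      -- absorbs.
      calc Real.exp ℓ * (1 - ℓ) ≤ Real.exp ℓ * Real.exp (-ℓ) :=
            mul_le_mul_of_nonneg_left (Real.one_sub_le_exp_neg ℓ) (Real.exp_pos _).le
        _ = 1 := by rw [← Real.exp_add, add_neg_cancel, Real.exp_zero]
    · refine Measurable.ennreal_ofReal (Measurable.mul (Measurable.exp ?_)
        (measurable_const.sub (Measurable.hellingerLoss (fun S => by fun_prop) (by fun_prop)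
          (by fun_prop))))
      exact ((hZ.comp measurable_fst).div_const 2).add
        ((hL.comp ((measurable_restr _).comp measurable_fst)).const_mul _)

/-- The maximum likelihood estimator over a class with a finite multiplicative `ε`-net. -/
theorem integral_hellingerLoss_epochPredictor_le (𝒟 : Measure (X × Cube N)) [IsProbabilityMeasure 𝒟]
    (A : BarrierERMAlgorithm K F γ) {fstar : X → Cube N} (hfF : fstar ∈ F) (hf : Measurable fstar)
    (hFpos : ∀ f ∈ F, ∀ x i, 0 < (f x i : ℝ)) {ι : Type*} [Fintype ι] [Nonempty ι]
    {g : ι → X → Cube N} (hg : ∀ j, Measurable (g j)) (hgpos : ∀ j x i, 0 < (g j x i : ℝ))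
    {ε : ℝ} (hε : 0 ≤ ε) (hnet : ∀ f ∈ F, ∃ j, ∀ x, LogClose ε (f x) (g j x)) {m : ℕ}
    (hm : 1 ≤ m) (hτ : τ m ≤ τ (m + 1)) :
    ((τ (m + 1) - τ m : ℕ) : ℝ) * ∫ p, hellingerLoss (epochPolicy A m (restr hτ p.1) p.2.1 p.2.2)
        (epochPredictor A (m + 1) p.1 p.2.1) (fstar p.2.1) ∂((runLaw 𝒟 A fstar (τ (m + 1))).prod 𝒟)
      ≤ Real.log (Fintype.card ι) + 2 * (τ (m + 1) - τ m : ℕ) * ε := by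
  have := isProbabilityMeasure_runLaw 𝒟 A hf (τ (m + 1))
  set n : ℕ := τ (m + 1) - τ m with hn
  have hnτ : τ m + n ≤ τ (m + 1) := by omega
  set P := runLaw 𝒟 A fstar (τ (m + 1))
  set M : ℝ := (Fintype.card ι : ℝ) with hM
  have hM0 : 0 < M := by rw [hM]; exact_mod_cast Fintype.card_pos
  have hJ : Integrable (fun p : (Fin (τ (m + 1)) → Round X N K) × X × Cube N =>
      hellingerLoss (epochPolicy A m (restr hτ p.1) p.2.1 p.2.2)
        (epochPredictor A (m + 1) p.1 p.2.1) (fstar p.2.1)) (P.prod 𝒟) :=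
    integrable_of_mem_Icc (Measurable.hellingerLoss (fun S => by fun_prop) (by fun_prop)
      (by fun_prop)) fun p => hellingerLoss_mem_Icc (epochPolicy_mem A m _ _ _) _ _
  rw [integral_prod _ hJ, ← integral_const_mul]
  change ∫ h, n * epochLoss 𝒟 A fstar m (restr hτ h) (epochPredictor A (m + 1) h) ∂P ≤ _
  have hJ' : Integrable (fun h => (n : ℝ) * epochLoss 𝒟 A fstar m (restr hτ h)
      (epochPredictor A (m + 1) h)) P := hJ.integral_prod_left.const_mul _
  set Z : ι → (Fin (τ (m + 1)) → Round X N K) → ℝ := fun j h =>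
    Real.exp (logRatio fstar (g j) m n (restr hnτ h) / 2 +
      n * epochLoss 𝒟 A fstar m (restr hτ h) (g j)) with hZdef
  have hZ : ∀ j, Integrable (Z j) P ∧ ∫ h, Z j h ∂P ≤ 1 := by
    intro j
    have hmeas : Measurable fun h : Fin (τ m + n) → Round X N K =>
        Real.exp (logRatio fstar (g j) m n h / 2 +
          n * epochLoss 𝒟 A fstar m (restr (Nat.le_add_right _ _) h) (g j)) :=
      (((measurable_logRatio hf (hg j) m n).div_const 2).add
        (((measurable_epochLoss 𝒟 A hf (hg j) m).comp (measurable_restr _)).const_mul _)).exp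
    have hle : ∫⁻ h, ENNReal.ofReal (Z j h) ∂P ≤ 1 := by
      refine le_trans (le_of_eq ?_)
        (lintegral_exp_logRatio_le 𝒟 A hf (hg j) (hFpos _ hfF) (hgpos j) hm n hnτ)
      exact (measurePreserving_restr 𝒟 A hf hnτ).lintegral_comp hmeas.ennreal_ofReal
    have hZm : Measurable (Z j) := hmeas.comp (measurable_restr hnτ)
    have h0 : 0 ≤ᵐ[P] Z j := Filter.Eventually.of_forall fun h => (Real.exp_pos _).le
    refine ⟨⟨hZm.aestronglyMeasurable, ?_⟩, ?_⟩
    · rw [hasFiniteIntegral_iff_ofReal h0]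
      exact hle.trans_lt ENNReal.one_lt_top
    · rw [integral_eq_lintegral_of_nonneg_ae h0 hZm.aestronglyMeasurable]
      exact ENNReal.toReal_le_of_le_ofReal zero_le_one (by simpa using hle)
  -- The net point close to the random predictor depends on the data; the sum of all `Z j` dominates
  -- whichever one it is, so no independence is needed.
  have hpt : ∀ h, n * epochLoss 𝒟 A fstar m (restr hτ h) (epochPredictor A (m + 1) h) ≤
      (∑ j, Z j h) / M + (Real.log M - 1 + 2 * n * ε) := by
    intro h
    obtain ⟨hF1, hERM⟩ := A.isERM (m + 1) (prevData (m + 1) h)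
    set f : X → Cube N := epochPredictor A (m + 1) h with hfdef
    change f ∈ F at hF1
    obtain ⟨j, hj⟩ := hnet f hF1
    have h1 : epochLoss 𝒟 A fstar m (restr hτ h) f ≤
        epochLoss 𝒟 A fstar m (restr hτ h) (g j) + ε := by
      have hfm : Measurable f := by rw [hfdef]; fun_prop
      calc _ ≤ ∫ p, (hellingerLoss (epochPolicy A m (restr hτ h) p.1 p.2) (g j p.1) (fstar p.1)
            + ε) ∂𝒟 :=
            integral_mono (integrable_hellingerLoss 𝒟 A hf hfm m _)
              ((integrable_hellingerLoss 𝒟 A hf (hg j) m _).add (integrable_const ε)) fun p =>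
                (hj p.1).hellingerLoss_le hε _ (epochPolicy_mem A m _ _ _)
        _ = _ := by
          rw [integral_add (integrable_hellingerLoss 𝒟 A hf (hg j) m _) (integrable_const ε)]
          simp [epochLoss]
    -- The minimizer does at least as well as `fstar` on exactly the rounds of epoch `m`, the data
    -- of epoch `m + 1`.
    have h2 : 0 ≤ logRatio fstar f m n (restr hnτ h) := by
      rw [logRatio, Finset.sum_sub_distrib, sub_nonneg]
      exact hERM fstar hfF
    have h3 : logRatio fstar f m n (restr hnτ h) ≤
        logRatio fstar (g j) m n (restr hnτ h) + n * (2 * ε) := by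
      have : (n : ℝ) * (2 * ε) = ∑ _k : Fin n, 2 * ε := by simp
      rw [logRatio, logRatio, this, ← Finset.sum_add_distrib]
      refine Finset.sum_le_sum fun k _ => ?_
      have := (hj (restr hnτ h (Fin.natAdd (τ m) k)).1).logLoss_le hε (hFpos f hF1 _) (hgpos j _)
        (restr hnτ h (Fin.natAdd (τ m) k)).2.2.1.1 (restr hnτ h (Fin.natAdd (τ m) k)).2.2.2
      linarith
    have hW : Z j h ≤ ∑ j, Z j h :=
      Finset.single_le_sum (f := fun j => Z j h) (fun j _ => (Real.exp_pos _).le)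
        (Finset.mem_univ j)
    have hW0 : 0 < ∑ j, Z j h := (Real.exp_pos _).trans_le hW
    have h4 := Real.log_le_log (Real.exp_pos _) hW
    rw [hZdef, Real.log_exp] at h4
    -- The tangent of the logarithm at `M` plays the role of Jensen's inequality: it is linear in
    -- the sum, whose expectation is at most `M`.
    have h5 := Real.log_le_sub_one_of_pos (div_pos hW0 hM0)
    rw [Real.log_div hW0.ne' hM0.ne'] at h5
    have hn0 : (0 : ℝ) ≤ n := n.cast_nonneg
    have h6 := mul_le_mul_of_nonneg_left h1 hn0
    simp only [hZdef] at h5 ⊢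
    linarith
  have hIW : Integrable (fun h => (∑ j, Z j h) / M) P :=
    (integrable_finsetSum _ fun j _ => (hZ j).1).div_const _
  refine (integral_mono hJ' (hIW.add (integrable_const _)) hpt).trans ?_
  have hsum : (∫ h, (∑ j, Z j h) ∂P) / M ≤ 1 := by
    rw [div_le_one hM0, integral_finsetSum _ fun j _ => (hZ j).1]
    calc _ ≤ ∑ _j : ι, (1 : ℝ) := Finset.sum_le_sum fun j _ => (hZ j).2
      _ = M := by simp [hM]
  rw [integral_add' hIW (integrable_const _), integral_div, integral_const, probReal_univ, one_smul]
  linarith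

end

/-! ### Induction over the epochs and summation over the rounds -/

section

theorem τ_le_succ (m : ℕ) : τ m ≤ τ (m + 1) :=
  Nat.sub_le_sub_right (Nat.pow_le_pow_right two_pos (by omega)) 1

theorem τ_sub_τ (m : ℕ) : τ (m + 1 + 1) - τ (m + 1) = 2 ^ m := by
  have := Nat.one_le_two_pow (n := m)
  simp only [τ, Nat.add_sub_cancel, pow_succ]
  omega

theorem nonempty_assortment {N K : ℕ} (hK : 1 ≤ K) (hKN : K ≤ N) : Nonempty (Assortment N K) :=
  ⟨{⟨0, by omega⟩}, by simp, by simpa using hK⟩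

variable {X : Type*} [MeasurableSpace X] {N K : ℕ} {F : Set (X → Cube N)} {γ : ℕ → ℝ}

/-- The Hellinger loss of the predictor of epoch `m + 2` under the policy of epoch `m + 1`. -/
def predictionLoss (A : BarrierERMAlgorithm K F γ) (fstar : X → Cube N) (m : ℕ)
    (p : (Fin (τ (m + 1 + 1)) → Round X N K) × X × Cube N) : ℝ :=
  hellingerLoss (epochPolicy A (m + 1) (restr (τ_le_succ (m + 1)) p.1) p.2.1 p.2.2)
    (epochPredictor A (m + 1 + 1) p.1 p.2.1) (fstar p.2.1)

/-- The additive error in the comparison between the losses predicted in epoch `m + 1` and the true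
losses. -/
def comparisonError (A : BarrierERMAlgorithm K F γ) (fstar : X → Cube N) :
    (m : ℕ) → (Fin (τ (m + 1)) → Round X N K) × X × Cube N → ℝ
  | 0, _ => 1
  | m + 1, p => 8 / 3 * (((K : ℝ) + 1) ^ 4 / γ (m + 1) * N / 8 +
      32 * γ (m + 1) * predictionLoss A fstar m p +
        comparisonError A fstar m (restr (τ_le_succ (m + 1)) p.1, p.2) / 8)

/-- In the first epoch there are no data, but gaps lie in `[0, 1]`, so the error 1 is trivial. Later
epochs use that the data came from the policy built on the preceding predictor, whose gaps are
controlled by induction. -/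
theorem rewardGap_epochPredictor_comparison [Nonempty (Assortment N K)] (hγ : ∀ m, 0 < γ m)
    (A : BarrierERMAlgorithm K F γ) (fstar : X → Cube N) (m : ℕ)
    (p : (Fin (τ (m + 1)) → Round X N K) × X × Cube N) (S : Assortment N K) :
    rewardGap K S.1 (epochPredictor A (m + 1) p.1 p.2.1) p.2.2 ≤
        2 * rewardGap K S.1 (fstar p.2.1) p.2.2 + comparisonError A fstar m p ∧
      rewardGap K S.1 (fstar p.2.1) p.2.2 ≤
        2 * rewardGap K S.1 (epochPredictor A (m + 1) p.1 p.2.1) p.2.2 +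
          comparisonError A fstar m p := by
  induction m generalizing S with
  | zero =>
    have h1 := rewardGap_nonneg S (fstar p.2.1) p.2.2
    have h2 := rewardGap_nonneg S (epochPredictor A (0 + 1) p.1 p.2.1) p.2.2
    have h3 := rewardGap_le_one (K := K) S.1 (fstar p.2.1) p.2.2
    have h4 := rewardGap_le_one (K := K) S.1 (epochPredictor A (0 + 1) p.1 p.2.1) p.2.2
    rw [comparisonError]
    constructor <;> linarith
  | succ m ih =>
    refine rewardGap_comparison (u := epochPredictor A (m + 1) (restr (τ_le_succ (m + 1)) p.1) p.2.1)
      (fun S => ?_) (fun S => (ih (restr (τ_le_succ (m + 1)) p.1, p.2) S).1) S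
    have := (isBarrierArgmax_epochPolicy A (m + 1) (restr (τ_le_succ (m + 1)) p.1) p.2.1
      p.2.2).abs_expReward_sub_le (hγ _) (epochPredictor A (m + 1 + 1) p.1 p.2.1) (fstar p.2.1) S
    rw [predictionLoss]
    linarith

theorem integrable_predictionLoss (𝒟 : Measure (X × Cube N)) [IsProbabilityMeasure 𝒟]
    (A : BarrierERMAlgorithm K F γ) {fstar : X → Cube N} (hf : Measurable fstar) (m : ℕ) :
    Integrable (predictionLoss A fstar m) ((runLaw 𝒟 A fstar (τ (m + 1 + 1))).prod 𝒟) := by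
  have := isProbabilityMeasure_runLaw 𝒟 A hf (τ (m + 1 + 1))
  exact integrable_of_mem_Icc (Measurable.hellingerLoss (fun S => by fun_prop) (by fun_prop)
    (by fun_prop)) fun p => hellingerLoss_mem_Icc (epochPolicy_mem A _ _ _ _) _ _

theorem measurePreserving_prodMap_restr (𝒟 : Measure (X × Cube N)) [IsProbabilityMeasure 𝒟]
    (A : BarrierERMAlgorithm K F γ) {fstar : X → Cube N} (hf : Measurable fstar) {s t : ℕ}
    (hst : s ≤ t) :
    MeasurePreserving (fun p : (Fin t → Round X N K) × X × Cube N => (restr hst p.1, p.2))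
      ((runLaw 𝒟 A fstar t).prod 𝒟) ((runLaw 𝒟 A fstar s).prod 𝒟) := by
  have := isProbabilityMeasure_runLaw 𝒟 A hf s
  have := isProbabilityMeasure_runLaw 𝒟 A hf t
  exact (measurePreserving_restr 𝒟 A hf hst).prod (MeasurePreserving.id 𝒟)

theorem integrable_comp_restr (𝒟 : Measure (X × Cube N)) [IsProbabilityMeasure 𝒟]
    (A : BarrierERMAlgorithm K F γ) {fstar : X → Cube N} (hf : Measurable fstar) {s t : ℕ}
    (hst : s ≤ t) {f : (Fin s → Round X N K) × X × Cube N → ℝ}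
    (hI : Integrable f ((runLaw 𝒟 A fstar s).prod 𝒟)) :
    Integrable (fun p => f (restr hst p.1, p.2)) ((runLaw 𝒟 A fstar t).prod 𝒟) :=
  (measurePreserving_prodMap_restr 𝒟 A hf hst).integrable_comp_of_integrable hI

theorem integrable_comparisonError (𝒟 : Measure (X × Cube N)) [IsProbabilityMeasure 𝒟]
    (A : BarrierERMAlgorithm K F γ) {fstar : X → Cube N} (hf : Measurable fstar) (m : ℕ) :
    Integrable (comparisonError A fstar m) ((runLaw 𝒟 A fstar (τ (m + 1))).prod 𝒟) := by
  induction m with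
  | zero =>
    have := isProbabilityMeasure_runLaw 𝒟 A hf (τ (0 + 1))
    exact integrable_const 1
  | succ m ih =>
    have := isProbabilityMeasure_runLaw 𝒟 A hf (τ (m + 1 + 1))
    exact (((integrable_const _).add ((integrable_predictionLoss 𝒟 A hf m).const_mul _)).add
      ((integrable_comp_restr 𝒟 A hf (τ_le_succ (m + 1)) ih).div_const 8)).const_mul _

theorem integral_comp_restr (𝒟 : Measure (X × Cube N)) [IsProbabilityMeasure 𝒟]
    (A : BarrierERMAlgorithm K F γ) {fstar : X → Cube N} (hf : Measurable fstar) {s t : ℕ}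
    (hst : s ≤ t) {f : (Fin s → Round X N K) × X × Cube N → ℝ}
    (hI : Integrable f ((runLaw 𝒟 A fstar s).prod 𝒟)) :
    ∫ p, f (restr hst p.1, p.2) ∂((runLaw 𝒟 A fstar t).prod 𝒟) =
      ∫ p, f p ∂((runLaw 𝒟 A fstar s).prod 𝒟) := by
  have h := measurePreserving_prodMap_restr 𝒟 A hf hst
  conv_rhs => rw [← h.map_eq]
  rw [integral_map h.measurable.aemeasurable (by rw [h.map_eq]; exact hI.aestronglyMeasurable)]

theorem integral_comparisonError_succ (𝒟 : Measure (X × Cube N)) [IsProbabilityMeasure 𝒟]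
    (A : BarrierERMAlgorithm K F γ) {fstar : X → Cube N} (hf : Measurable fstar) (m : ℕ) :
    ∫ p, comparisonError A fstar (m + 1) p ∂((runLaw 𝒟 A fstar (τ (m + 1 + 1))).prod 𝒟) =
      8 / 3 * (((K : ℝ) + 1) ^ 4 / γ (m + 1) * N / 8 + 32 * γ (m + 1) *
        ∫ p, predictionLoss A fstar m p ∂((runLaw 𝒟 A fstar (τ (m + 1 + 1))).prod 𝒟) +
          (∫ p, comparisonError A fstar m p ∂((runLaw 𝒟 A fstar (τ (m + 1))).prod 𝒟)) / 8) := by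
  have := isProbabilityMeasure_runLaw 𝒟 A hf (τ (m + 1 + 1))
  have h1 := integrable_predictionLoss 𝒟 A hf m
  have h2 := integrable_comparisonError 𝒟 A hf m
  have h3 := integrable_comp_restr 𝒟 A hf (τ_le_succ (m + 1)) h2
  have h4 : Integrable (fun p => ((K : ℝ) + 1) ^ 4 / γ (m + 1) * N / 8 + 32 * γ (m + 1) *
      predictionLoss A fstar m p) ((runLaw 𝒟 A fstar (τ (m + 1 + 1))).prod 𝒟) :=
    (integrable_const _).add (h1.const_mul _)
  simp only [comparisonError]
  rw [integral_const_mul, integral_add h4 (h3.div_const 8),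
    integral_add (integrable_const _) (h1.const_mul _), integral_const_mul,
    integral_const, probReal_univ, one_smul, integral_div, integral_comp_restr 𝒟 A hf _ h2]

/-- The true gap is compared with the predicted one, which the barrier policy keeps below `Λ N` on
average. -/
theorem policyGap_le [Nonempty (Assortment N K)] (hγ : ∀ m, 0 < γ m)
    (A : BarrierERMAlgorithm K F γ) (fstar : X → Cube N) {m t : ℕ} (h1 : τ (m + 1) ≤ t)
    (h2 : t < τ (m + 1 + 1)) (p : (Fin t → Round X N K) × X × Cube N) :
    policyGap A fstar t p ≤ 2 * (((K : ℝ) + 1) ^ 4 / γ (m + 1) * N) +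
      comparisonError A fstar m (restr h1 p.1, p.2) := by
  have hq := isBarrierArgmax_epochPolicy A (m + 1) (restr h1 p.1) p.2.1 p.2.2
  rw [policyGap, policy_epochData_eq A (Nat.le_add_left 1 m) h1 h2]
  calc _ ≤ ∑ S, epochPolicy A (m + 1) (restr h1 p.1) p.2.1 p.2.2 S *
        (2 * rewardGap K S.1 (epochPredictor A (m + 1) (restr h1 p.1) p.2.1) p.2.2 +
          comparisonError A fstar m (restr h1 p.1, p.2)) :=
        Finset.sum_le_sum fun S _ => mul_le_mul_of_nonneg_left
          (rewardGap_epochPredictor_comparison hγ A fstar m (restr h1 p.1, p.2) S).2 (hq.1.1.1 S)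
    _ = 2 * ∑ S, epochPolicy A (m + 1) (restr h1 p.1) p.2.1 p.2.2 S *
        rewardGap K S.1 (epochPredictor A (m + 1) (restr h1 p.1) p.2.1) p.2.2 +
          comparisonError A fstar m (restr h1 p.1, p.2) := by
        simp only [mul_add, Finset.sum_add_distrib, ← Finset.sum_mul, hq.1.1.2, one_mul,
          Finset.mul_sum]
        congr 1
        exact Finset.sum_congr rfl fun S _ => by ring
    _ ≤ _ := by
        have := hq.sum_mul_rewardGap_le (hγ _)
        linarith

/-- The parameters of the barrier policies for which the predictors are trusted to have expected
Hellinger loss at most `L / n` after an epoch of length `n`. -/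
def barrierParam (N K : ℕ) (L : ℝ) (m : ℕ) : ℝ := ((K : ℝ) + 1) ^ 2 * (√N / √L) * √2 ^ m

theorem barrierParam_pos (hN : 1 ≤ N) {L : ℝ} (hL : 0 < L) (m : ℕ) : 0 < barrierParam N K L m := by
  have : (0 : ℝ) < N := by exact_mod_cast hN
  rw [barrierParam]
  positivity

theorem div_barrierParam (hN : 1 ≤ N) {L : ℝ} (hL : 0 < L) (m : ℕ) :
    ((K : ℝ) + 1) ^ 4 / barrierParam N K L m * N = ((K : ℝ) + 1) ^ 2 * √N * √L / √2 ^ m := by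
  have hN' : (0 : ℝ) < N := by exact_mod_cast hN
  have h := Real.sq_sqrt hN'.le
  have h1 : 0 < √(N : ℝ) := Real.sqrt_pos.2 hN'
  have h2 : 0 < √L := Real.sqrt_pos.2 hL
  rw [barrierParam]
  nth_rewrite 2 [← h]
  field_simp

theorem integral_comparisonError_le (hN : 1 ≤ N) (hK : 1 ≤ K) {L : ℝ} (hL : 1 / 4 ≤ L)
    (𝒟 : Measure (X × Cube N)) [IsProbabilityMeasure 𝒟]
    (A : BarrierERMAlgorithm K F (barrierParam N K L)) {fstar : X → Cube N} (hf : Measurable fstar)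
    (m : ℕ) (hJ : ∀ j < m, (2 : ℝ) ^ j *
      ∫ p, predictionLoss A fstar j p ∂((runLaw 𝒟 A fstar (τ (j + 1 + 1))).prod 𝒟) ≤ L) :
    ∫ p, comparisonError A fstar m p ∂((runLaw 𝒟 A fstar (τ (m + 1))).prod 𝒟) ≤
      500 * (((K : ℝ) + 1) ^ 2 * √N * √L / √2 ^ (m + 1)) := by
  have hN' : (1 : ℝ) ≤ √N := Real.one_le_sqrt.2 (by exact_mod_cast hN)
  have hL0 : 0 < L := by linarith
  have hL' : 1 / 2 ≤ √L := Real.le_sqrt_of_sq_le (by linarith)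
  have hσ2 : √2 ^ 2 = (2 : ℝ) := Real.sq_sqrt zero_le_two
  have hσ0 : (0 : ℝ) < √2 := by positivity
  have hσ : √2 ≤ (1.42 : ℝ) := Real.sqrt_le_iff.2 ⟨by norm_num, by norm_num⟩
  induction m with
  | zero =>
    have := isProbabilityMeasure_runLaw 𝒟 A hf (τ (0 + 1))
    have hK' : (1 : ℝ) ≤ K := by exact_mod_cast hK
    -- The lower bound on `L` serves here: it makes the trivial error 1 of the first epoch smaller
    -- than the claimed bound.
    have h1 : (4 : ℝ) ≤ ((K : ℝ) + 1) ^ 2 := by nlinarith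
    have h2 : 4 * 1 * (1 / 2) ≤ ((K : ℝ) + 1) ^ 2 * √N * √L := by gcongr
    simp only [comparisonError, integral_const, probReal_univ, one_smul, zero_add, pow_one]
    rw [← mul_div_assoc, le_div_iff₀ hσ0]
    linarith
  | succ m ih =>
    have h1 := ih fun j hj => hJ j (hj.trans m.lt_succ_self)
    have h2 := hJ m m.lt_succ_self
    rw [integral_comparisonError_succ 𝒟 A hf, div_barrierParam hN hL0]
    set J := ∫ p, predictionLoss A fstar m p ∂((runLaw 𝒟 A fstar (τ (m + 1 + 1))).prod 𝒟)
    -- The parameter is tuned so that `γ` times the loss `L / 2^m` is of the same order `y` as the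
    -- barrier term `Λ N`.
    have h3 : barrierParam N K L (m + 1) * J ≤
        2 * (((K : ℝ) + 1) ^ 2 * √N * √L / √2 ^ (m + 1)) := by
      have h4 : J ≤ L / 2 ^ m := by
        rw [le_div_iff₀ (by positivity)]
        linarith
      refine (mul_le_mul_of_nonneg_left h4 (barrierParam_pos hN hL0 _).le).trans (le_of_eq ?_)
      have h5 : (2 : ℝ) ^ m * 2 = √2 ^ (m + 1) * √2 ^ (m + 1) := by
        rw [← pow_succ, ← mul_pow, Real.mul_self_sqrt zero_le_two]
      have h6 : √L ^ 2 = L := Real.sq_sqrt hL0.le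
      have h7 : L / 2 ^ m = 2 * √L ^ 2 / (√2 ^ (m + 1) * √2 ^ (m + 1)) := by
        rw [← h5, h6]
        field_simp
      rw [barrierParam, h7]
      field_simp
    set y := ((K : ℝ) + 1) ^ 2 * √N * √L / √2 ^ (m + 1) with hy
    have hy0 : 0 ≤ y := by positivity
    have h8 : ((K : ℝ) + 1) ^ 2 * √N * √L / √2 ^ (m + 1 + 1) = y / √2 := by
      rw [hy, pow_succ _ (m + 1), div_div]
    -- The previous error enters with weight `8/3 · 1/8 = 1/3`, less than the decay `1/√2` per
    -- epoch. The constant 500 works as `8/3 · (1/8 + 64 + 500/8) < 500 · 0.7`.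
    have h9 : 0.7 * y ≤ y / √2 := by
      rw [le_div_iff₀ hσ0]
      nlinarith
    rw [h8]
    linarith

theorem sum_inv_sqrt_le (T : ℕ) : ∑ t ∈ Finset.range T, 1 / √((t : ℝ) + 1) ≤ 2 * √T := by
  induction T with
  | zero => simp
  | succ T ih =>
    rw [Finset.sum_range_succ]
    have h1 := Real.sq_sqrt (Nat.cast_nonneg (α := ℝ) T)
    have h2 := Real.sq_sqrt (show (0 : ℝ) ≤ T + 1 by positivity)
    have h3 : 0 < √((T : ℝ) + 1) := by positivity
    have h4 : 1 / √((T : ℝ) + 1) ≤ 2 * √((T : ℝ) + 1) - 2 * √T := by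
      rw [div_le_iff₀ h3]
      nlinarith [sq_nonneg (√((T : ℝ) + 1) - √T)]
    push_cast
    linarith

/-- The regret of the epoch algorithm for a class with a finite multiplicative `ε`-net. -/
theorem regret_le_of_net (hK : 1 ≤ K) (hKN : K ≤ N) {L : ℝ} (hL : 1 / 4 ≤ L) {T : ℕ}
    (𝒟 : Measure (X × Cube N)) [IsProbabilityMeasure 𝒟]
    (A : BarrierERMAlgorithm K F (barrierParam N K L)) {fstar : X → Cube N} (hfF : fstar ∈ F)
    (hf : Measurable fstar) (hFpos : ∀ f ∈ F, ∀ x i, 0 < (f x i : ℝ)) {ι : Type*} [Fintype ι]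
    [Nonempty ι] {g : ι → X → Cube N} (hg : ∀ j, Measurable (g j))
    (hgpos : ∀ j x i, 0 < (g j x i : ℝ)) {ε : ℝ} (hε : 0 ≤ ε)
    (hnet : ∀ f ∈ F, ∃ j, ∀ x, LogClose ε (f x) (g j x))
    (hι : Real.log (Fintype.card ι) + 2 * T * ε ≤ L) :
    regret 𝒟 A fstar T ≤ 4016 * (K : ℝ) ^ 2 * √(N * T * L) := by
  have := nonempty_assortment hK hKN
  have hN : 1 ≤ N := hK.trans hKN
  have hL0 : 0 < L := by linarith
  have hK' : (1 : ℝ) ≤ K := by exact_mod_cast hK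
  set y : ℝ := ((K : ℝ) + 1) ^ 2 * √N * √L with hy
  have hy0 : 0 ≤ y := by positivity
  have hround : ∀ t ∈ Finset.range T, ∫ p, policyGap A fstar t p ∂((runLaw 𝒟 A fstar t).prod 𝒟) ≤
      502 * y * (1 / √((t : ℝ) + 1)) := by
    intro t ht
    have hT : t + 1 ≤ T := Finset.mem_range.1 ht
    have := isProbabilityMeasure_runLaw 𝒟 A hf t
    set m := Nat.log 2 (t + 1) with hm
    have h1 : τ (m + 1) ≤ t := τ_epochOf_le t
    have h2 : t < τ (m + 1 + 1) := lt_τ_epochOf_succ t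
    have hmT : 2 ^ m ≤ t + 1 := Nat.pow_log_le_self 2 (Nat.succ_ne_zero t)
    have hC := integrable_comparisonError 𝒟 A hf m
    have hC' := integrable_comp_restr 𝒟 A hf h1 hC
    have h3 := integral_comparisonError_le hN hK hL 𝒟 A hf m fun j hj => by
      have h4 := integral_hellingerLoss_epochPredictor_le 𝒟 A hfF hf hFpos hg hgpos hε hnet
        (m := j + 1) (Nat.le_add_left 1 j) (τ_le_succ (j + 1))
      rw [τ_sub_τ] at h4
      push_cast at h4
      refine h4.trans (le_trans ?_ hι)
      -- Only epochs completed before round `t + 1` matter, so their lengths are at most `T` and the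
      -- net error is at most `2 T ε`.
      have h5 : (2 : ℝ) ^ j ≤ T := by
        have := (Nat.pow_le_pow_right two_pos hj.le).trans (hmT.trans hT)
        exact_mod_cast this
      gcongr
    have h6 : ∫ p, policyGap A fstar t p ∂((runLaw 𝒟 A fstar t).prod 𝒟) ≤
        2 * (y / √2 ^ (m + 1)) + 500 * (y / √2 ^ (m + 1)) := by
      calc _ ≤ ∫ p, (2 * (((K : ℝ) + 1) ^ 4 / barrierParam N K L (m + 1) * N) +
            comparisonError A fstar m (restr h1 p.1, p.2)) ∂((runLaw 𝒟 A fstar t).prod 𝒟) :=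
            integral_mono (integrable_of_mem_Icc (measurable_policyGap A hf t)
              (policyGap_mem_Icc A fstar t)) ((integrable_const _).add hC')
              (policyGap_le (barrierParam_pos hN hL0) A fstar h1 h2)
        _ = 2 * (y / √2 ^ (m + 1)) + ∫ p, comparisonError A fstar m p
              ∂((runLaw 𝒟 A fstar (τ (m + 1))).prod 𝒟) := by
            rw [integral_add (integrable_const _) hC', integral_comp_restr 𝒟 A hf h1 hC,
              integral_const, probReal_univ, one_smul, div_barrierParam hN hL0]
        _ ≤ _ := by gcongr
    -- Since `t + 1 < 2^(m+1)`, the geometric rate in the epoch becomes the rate `1 / √(t+1)` in the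
    -- round, summable without splitting into epochs.
    have h7 : √((t : ℝ) + 1) ≤ √2 ^ (m + 1) := by
      refine Real.sqrt_le_iff.2 ⟨by positivity, ?_⟩
      rw [← pow_mul, mul_comm, pow_mul, Real.sq_sqrt zero_le_two]
      have := (Nat.lt_pow_succ_log_self (b := 2) one_lt_two (t + 1)).le
      exact_mod_cast this
    have h8 : y / √2 ^ (m + 1) ≤ y / √((t : ℝ) + 1) :=
      div_le_div_of_nonneg_left hy0 (by positivity) h7
    rw [mul_assoc, mul_one_div]
    linarith
  rw [regret_eq_sum 𝒟 A hf]
  refine (Finset.sum_le_sum hround).trans ?_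
  rw [← Finset.mul_sum]
  calc 502 * y * ∑ t ∈ Finset.range T, 1 / √((t : ℝ) + 1) ≤ 502 * y * (2 * √T) :=
        mul_le_mul_of_nonneg_left (sum_inv_sqrt_le T) (by positivity)
    _ = 1004 * ((K : ℝ) + 1) ^ 2 * √(N * T * L) := by
        rw [hy, Real.sqrt_mul (by positivity), Real.sqrt_mul (by positivity)]
        ring
    _ ≤ 1004 * (4 * (K : ℝ) ^ 2) * √(N * T * L) := by
        gcongr
        nlinarith
    _ = _ := by ring

end

/-! ### Nets for the finite and the linear class -/

section

theorem measurable_cube {Y : Type*} [MeasurableSpace Y] {N : ℕ} {f : Y → Cube N}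
    (hf : ∀ i, Measurable fun y => (f y i : ℝ)) : Measurable f :=
  measurable_pi_lambda _ fun i => (hf i).subtype_mk

theorem measurable_exp_inner {d N : ℕ} {𝒳 : Set (Fin N → EuclideanSpace ℝ (Fin d))}
    (θ : EuclideanSpace ℝ (Fin d)) (B : ℝ) (i : Fin N) :
    Measurable fun x : 𝒳 => Real.exp (min 0 (inner ℝ θ (x.1 i) - B)) := by
  have h : Continuous fun x : 𝒳 => Real.exp (min 0 (inner ℝ θ (x.1 i) - B)) := by
    have h0 : Continuous fun x : 𝒳 => (inner ℝ θ (x.1 i) : ℝ) :=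
      continuous_const.inner ((continuous_apply i).comp continuous_subtype_val)
    fun_prop
  exact h.measurable

theorem inner_sub_nonpos_of_mem_linearClass {d N : ℕ} {f : Cube N}
    {x : Fin N → EuclideanSpace ℝ (Fin d)} {θ : EuclideanSpace ℝ (Fin d)} {B : ℝ} {i : Fin N}
    (h : (f i : ℝ) = Real.exp (inner ℝ θ (x i) - B)) : inner ℝ θ (x i) - B ≤ 0 := by
  have := (f i).2.2
  rwa [h, Real.exp_le_one_iff] at this

theorem measurable_of_mem_linearClass {d N : ℕ} {𝒳 : Set (Fin N → EuclideanSpace ℝ (Fin d))}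
    {B : ℝ} {f : 𝒳 → Cube N} (hf : f ∈ linearClass 𝒳 B) : Measurable f := by
  obtain ⟨θ, -, h⟩ := hf
  refine measurable_cube fun i => ?_
  convert measurable_exp_inner (𝒳 := 𝒳) θ B i using 2 with x
  rw [min_eq_right (inner_sub_nonpos_of_mem_linearClass (h x i)), h]

/-- The value functions `exp (⟪θ, x i⟫ - B)`, clipped to `[0, 1]`, for the points `θ` of a grid. -/
def gridValue {d N : ℕ} (𝒳 : Set (Fin N → EuclideanSpace ℝ (Fin d))) (B δ : ℝ) (k : ℤ)
    (z : Fin d → Finset.Icc (-k) k) (x : 𝒳) : Cube N := fun i =>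
  ⟨Real.exp (min 0 (inner ℝ (WithLp.toLp 2 fun j => δ * ((z j).1 : ℝ)) (x.1 i) - B)),
    (Real.exp_pos _).le, Real.exp_le_one_iff.2 (min_le_left _ _)⟩

/-- Rounding each coordinate of `θ` down to the grid moves it by at most `δ`, hence the exponent by
at most `d δ` as the coordinates of `x i` are bounded by 1. -/
theorem exists_logClose_gridValue {d N : ℕ} {𝒳 : Set (Fin N → EuclideanSpace ℝ (Fin d))}
    (h𝒳 : ∀ x ∈ 𝒳, ∀ i, ‖x i‖ ≤ 1) {B δ : ℝ} (hδ : 0 < δ) {k : ℤ} (hk : B / δ ≤ k)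
    {f : 𝒳 → Cube N} (hf : f ∈ linearClass 𝒳 B) :
    ∃ z, ∀ x, LogClose (d * δ) (f x) (gridValue 𝒳 B δ k z x) := by
  obtain ⟨θ, hθ, h⟩ := hf
  have hθj : ∀ j, |θ j| ≤ B := fun j => by
    have := (PiLp.norm_apply_le θ j).trans hθ
    rwa [Real.norm_eq_abs] at this
  refine ⟨fun j => ⟨⌊θ j / δ⌋, Finset.mem_Icc.2 ⟨?_, ?_⟩⟩, fun x i => ?_⟩
  · rw [Int.le_floor]
    push_cast
    have : -B / δ ≤ θ j / δ := by gcongr; exact (abs_le.1 (hθj j)).1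
    rw [neg_div] at this
    linarith
  · have h1 : θ j / δ ≤ B / δ := by gcongr; exact (abs_le.1 (hθj j)).2
    exact Int.cast_le.1 ((Int.floor_le (θ j / δ)).trans (h1.trans hk))
  · set θ' : EuclideanSpace ℝ (Fin d) := WithLp.toLp 2 fun j => δ * (⌊θ j / δ⌋ : ℝ) with hθ'
    have h1 : |inner ℝ θ (x.1 i) - inner ℝ θ' (x.1 i)| ≤ d * δ := by
      rw [← inner_sub_left, PiLp.inner_apply]
      refine (Finset.abs_sum_le_sum_abs _ _).trans ?_
      have h2 : ∀ j, |inner ℝ ((θ - θ') j) (x.1 i j)| ≤ δ := fun j => by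
        have h3 : |(θ - θ') j| ≤ δ := by
          have h4 : (θ - θ') j = δ * Int.fract (θ j / δ) := by
            rw [Int.fract, mul_sub, mul_div_cancel₀ _ hδ.ne']
            simp [hθ']
          rw [h4, abs_mul, abs_of_pos hδ, abs_of_nonneg (Int.fract_nonneg _)]
          exact mul_le_of_le_one_right hδ.le (Int.fract_lt_one _).le
        have h5 : ‖x.1 i j‖ ≤ 1 := (PiLp.norm_apply_le _ j).trans (h𝒳 x.1 x.2 i)
        calc _ ≤ ‖(θ - θ') j‖ * ‖x.1 i j‖ := abs_real_inner_le_norm _ _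
          _ ≤ δ * 1 := mul_le_mul h3 h5 (norm_nonneg _) hδ.le
          _ = δ := mul_one δ
      simpa using Finset.sum_le_sum fun j (_ : j ∈ Finset.univ) => h2 j
    have h6 := inner_sub_nonpos_of_mem_linearClass (h x i)
    obtain ⟨h7, h8⟩ := abs_le.1 h1
    change (f x i : ℝ) ≤ _ * Real.exp (min 0 (inner ℝ θ' (x.1 i) - B)) ∧
      Real.exp (min 0 (inner ℝ θ' (x.1 i) - B)) ≤ _
    rw [h, ← Real.exp_add, ← Real.exp_add, Real.exp_le_exp, Real.exp_le_exp]
    constructor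
    -- A grid point may give a positive exponent; clipping it at 0 does no harm, because the
    -- exponent of `f`, which takes values in the cube, is nonpositive.
    · rcases min_cases 0 (inner ℝ θ' (x.1 i) - B) with h9 | h9 <;> rw [h9.1] <;> linarith
    · linarith [min_le_right 0 (inner ℝ θ' (x.1 i) - B)]

theorem two_thirds_le_log {x : ℝ} (hx : 2 ≤ x) : 2 / 3 ≤ Real.log x := by
  have := Real.log_le_log two_pos hx
  linarith [Real.log_two_gt_d9]

theorem log_card_grid_le {d T : ℕ} (hT : 2 ≤ T) (hdT : d ≤ T) {B : ℝ} (hB : 0 < B) :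
    Real.log (Fintype.card (Fin d → Finset.Icc (-⌈B * (d * T)⌉) ⌈B * (d * T)⌉)) ≤
      d * (3 * Real.log (max B 2) + 2 * Real.log T) := by
  have hk0 : 0 ≤ ⌈B * (d * T : ℝ)⌉ := Int.ceil_nonneg (by positivity)
  have hk := (Int.ceil_lt_add_one (B * (d * T : ℝ))).le
  set k := ⌈B * (d * T : ℝ)⌉
  have hcard : (Fintype.card (Fin d → Finset.Icc (-k) k) : ℝ) = (2 * k + 1) ^ d := by
    rw [Fintype.card_fun, Fintype.card_coe, Int.card_Icc, Fintype.card_fin, Nat.cast_pow]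
    congr 1
    have : (((k + 1 - -k).toNat : ℤ) : ℝ) = ((k + 1 - -k : ℤ) : ℝ) := by
      rw [Int.toNat_of_nonneg (by omega)]
    rw [Int.cast_natCast] at this
    rw [this]
    push_cast
    ring
  have hk0' : (0 : ℝ) ≤ k := by exact_mod_cast hk0
  have hT' : (2 : ℝ) ≤ T := by exact_mod_cast hT
  have hdT' : (d : ℝ) ≤ T := by exact_mod_cast hdT
  have hB1 := le_max_left B 2
  have hB2 := le_max_right B 2
  set b := max B 2
  rw [hcard, Real.log_pow]
  refine mul_le_mul_of_nonneg_left ?_ d.cast_nonneg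
  -- With `d ≤ T` the left side is at most `2 b T^2 + 3`, and `b ≥ 2` pays for the constants by two
  -- more powers of `b`.
  have h1 : 2 * (k : ℝ) + 1 ≤ b ^ 3 * (T : ℝ) ^ 2 := by
    have h2 : B * (d * T : ℝ) ≤ b * (T * T) := by gcongr
    have h3 : 2 * (2 * 2) ≤ b * (T * T : ℝ) := by gcongr
    have h4 : (3 : ℝ) ≤ b ^ 2 := by nlinarith
    have h5 : 3 * (b * (T * T : ℝ)) ≤ b ^ 2 * (b * (T * T)) := by gcongr
    nlinarith
  have h6 := Real.log_le_log (by linarith) h1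
  rw [Real.log_mul (by positivity) (by positivity), Real.log_pow, Real.log_pow] at h6
  exact_mod_cast h6

theorem regret_finite_le {N K T M : ℕ} {β : ℝ} (hK : 1 ≤ K) (hKN : K ≤ N) (hT : 2 ≤ T)
    (hβ : 0 < β) {X : Type*} [MeasurableSpace X] {F : Set (X → Cube N)} (hF : F.Finite)
    (hM : F.ncard = M) (hFm : ∀ f ∈ F, Measurable f ∧ ∀ x i, β ≤ (f x i : ℝ))
    {fstar : X → Cube N} (hf : fstar ∈ F) (𝒟 : Measure (X × Cube N)) [IsProbabilityMeasure 𝒟]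
    (A : BarrierERMAlgorithm K F (barrierParam N K (max (Real.log (M * T)) (1 / 4)))) :
    regret 𝒟 A fstar T ≤
      8032 * (K : ℝ) ^ 2 * √((N : ℝ) * T * Real.log (max (K / β) 2) * Real.log (M * T)) := by
  have : Finite F := hF
  have := Fintype.ofFinite F
  have : Nonempty F := ⟨⟨fstar, hf⟩⟩
  have hcard : Fintype.card F = M := by rw [← hM, Set.ncard, Set.encard,
    ENat.card_eq_coe_fintype_card, ENat.toNat_natCast]
  have hM1 : (1 : ℝ) ≤ M := by
    rw [← hcard]
    exact_mod_cast Fintype.card_pos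
  have hT' : (2 : ℝ) ≤ T := by exact_mod_cast hT
  have hlog := two_thirds_le_log (show (2 : ℝ) ≤ M * T by nlinarith)
  -- The maximum only keeps the parameters positive for `M = 0`, when there is no class at all.
  have hmax : max (Real.log (M * T)) (1 / 4) = Real.log (M * T) := max_eq_left (by linarith)
  have h := regret_le_of_net (ι := F) (g := fun f => f.1) (ε := 0) hK hKN (le_max_right _ _) 𝒟 A hf
    (hFm fstar hf).1 (fun f hf x i => hβ.trans_le ((hFm f hf).2 x i)) (fun f => (hFm f.1 f.2).1)
    (fun f x i => hβ.trans_le ((hFm f.1 f.2).2 x i)) le_rfl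
    (fun f hf => ⟨⟨f, hf⟩, fun x i => by simp⟩) (T := T) (by
      rw [hcard, mul_zero, add_zero, hmax]
      exact Real.log_le_log (by linarith) (by nlinarith))
  refine h.trans ?_
  have h2 := two_thirds_le_log (le_max_right (K / β) 2)
  -- The extra logarithm in the bound is at least `2/3 ≥ 1/4`, so it costs only a factor 2.
  have h3 : √(N * T * max (Real.log (M * T)) (1 / 4)) ≤
      2 * √((N : ℝ) * T * Real.log (max (K / β) 2) * Real.log (M * T)) := by
    rw [hmax]
    refine Real.sqrt_le_iff.2 ⟨by positivity, ?_⟩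
    have h0 : (0 : ℝ) ≤ N * T * Real.log (M * T) := by positivity
    rw [mul_pow, Real.sq_sqrt (by positivity)]
    nlinarith
  calc _ ≤ 4016 * (K : ℝ) ^ 2 *
        (2 * √((N : ℝ) * T * Real.log (max (K / β) 2) * Real.log (M * T))) := by gcongr
    _ = _ := by ring

theorem regret_linear_le {N K T d : ℕ} {B : ℝ} (hK : 1 ≤ K) (hKN : K ≤ N) (hT : 2 ≤ T)
    (hd : 1 ≤ d) (hB : 0 < B) {𝒳 : Set (Fin N → EuclideanSpace ℝ (Fin d))}
    (h𝒳 : ∀ x ∈ 𝒳, ∀ i, ‖x i‖ ≤ 1) {fstar : 𝒳 → Cube N} (hf : fstar ∈ linearClass 𝒳 B)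
    (𝒟 : Measure (𝒳 × Cube N)) [IsProbabilityMeasure 𝒟]
    (A : BarrierERMAlgorithm K (linearClass 𝒳 B)
      (barrierParam N K (18 * d * Real.log (max B 2) * Real.log T))) :
    regret 𝒟 A fstar T ≤
      20080 * (K : ℝ) ^ 2 *
        √((d : ℝ) * max B 2 * N * T * Real.log (max B 2) * Real.log T) := by
  have hT' : (2 : ℝ) ≤ T := by exact_mod_cast hT
  have hd' : (1 : ℝ) ≤ d := by exact_mod_cast hd
  have hK' : (1 : ℝ) ≤ K := by exact_mod_cast hK
  have hN' : (1 : ℝ) ≤ N := by exact_mod_cast hK.trans hKN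
  have hb2 := le_max_right B 2
  have ha := two_thirds_le_log hb2
  have hb := two_thirds_le_log hT'
  rcases le_or_gt T d with hTd | hdT
  -- For `T ≤ d` the claimed bound exceeds `T`, which always bounds the regret; this leaves `d < T`,
  -- as the grid count needs.
  · have hTd' : (T : ℝ) ≤ d := by exact_mod_cast hTd
    refine (regret_le_card 𝒟 A (measurable_of_mem_linearClass hf) T).trans ?_
    have h1 : (T : ℝ) / 2 ≤ √((d : ℝ) * max B 2 * N * T * Real.log (max B 2) * Real.log T) := by
      refine Real.le_sqrt_of_sq_le ?_
      calc ((T : ℝ) / 2) ^ 2 ≤ T * 2 * 1 * T * (2 / 3) * (2 / 3) := by nlinarith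
        _ ≤ _ := by gcongr
    have h2 : 20080 * 1 ^ 2 * ((T : ℝ) / 2) ≤ 20080 * (K : ℝ) ^ 2 *
        √((d : ℝ) * max B 2 * N * T * Real.log (max B 2) * Real.log T) := by gcongr
    linarith
  · have hab : 4 / 9 ≤ Real.log (max B 2) * Real.log T := by nlinarith
    have hδ : (0 : ℝ) < 1 / (d * T) := by positivity
    have hk : B / (1 / (d * T)) ≤ (⌈B * (d * T : ℝ)⌉ : ℝ) := by
      rw [div_div_eq_mul_div, div_one]
      exact Int.le_ceil _
    have hnet := fun f (hf : f ∈ linearClass 𝒳 B) => exists_logClose_gridValue h𝒳 hδ hk hf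
    obtain ⟨z, -⟩ := hnet fstar hf
    have : Nonempty (Fin d → Finset.Icc (-⌈B * (d * T : ℝ)⌉) ⌈B * (d * T : ℝ)⌉) := ⟨z⟩
    have h := regret_le_of_net (L := 18 * d * Real.log (max B 2) * Real.log T) hK hKN
      (by nlinarith) 𝒟 A hf
      (measurable_of_mem_linearClass hf)
      (fun f ⟨θ, _, hθ⟩ x i => by rw [hθ]; exact Real.exp_pos _)
      (fun z => measurable_cube fun i => measurable_exp_inner _ B i)
      (fun z x i => Real.exp_pos _) (by positivity) hnet (T := T) (by
        have h1 := log_card_grid_le hT hdT.le hB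
        -- The mesh `1 / (d T)` makes the net fine to `ε = 1 / T`, so its total cost is the constant
        -- 2. Both logarithms are at least `2/3`, so their product times 18 absorbs this and the
        -- log-cardinality per dimension.
        have h2 : 2 * (T : ℝ) * (d * (1 / (d * T))) = 2 := by field_simp
        have h3 : 3 * Real.log (max B 2) + 2 * Real.log T + 2 ≤
            18 * (Real.log (max B 2) * Real.log T) := by nlinarith
        have h4 : (d : ℝ) * (3 * Real.log (max B 2) + 2 * Real.log T + 2) ≤
            d * (18 * (Real.log (max B 2) * Real.log T)) := by gcongr
        rw [h2]
        linarith)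
    refine h.trans ?_
    -- Here `18 ≤ 25 · max B 2`; the factor `max B 2` is used only through its lower bound 2.
    have h5 : √(N * T * (18 * d * Real.log (max B 2) * Real.log T)) ≤
        5 * √((d : ℝ) * max B 2 * N * T * Real.log (max B 2) * Real.log T) := by
      refine Real.sqrt_le_iff.2 ⟨by positivity, ?_⟩
      have h0 : 0 ≤ (N : ℝ) * T * d * (Real.log (max B 2) * Real.log T) := by positivity
      rw [mul_pow, Real.sq_sqrt (by positivity)]
      nlinarith
    calc _ ≤ 4016 * (K : ℝ) ^ 2 *
          (5 * √((d : ℝ) * max B 2 * N * T * Real.log (max B 2) * Real.log T)) := by gcongr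
      _ = _ := by ring

end

end MNLBandit

end

theorem mainTheorem11 :
    -- finite class
    (∃ C : ℝ, 0 < C ∧
      ∀ (N K T M : ℕ) (β : ℝ), 1 ≤ K → K ≤ N → 2 ≤ T → 0 < β → β < 1 →
        ∃ γ : ℕ → ℝ, (∀ m, 0 < γ m) ∧
          ∀ (X : Type*) [MeasurableSpace X] (F : Set (X → MNLBandit.Cube N)),
            F.Finite → F.ncard = M →
            (∀ f ∈ F, Measurable f ∧ ∀ x i, β ≤ (f x i : ℝ)) →
            ∀ fstar ∈ F,
            ∀ (𝒟 : Measure (X × MNLBandit.Cube N)) [IsProbabilityMeasure 𝒟]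
              (A : MNLBandit.BarrierERMAlgorithm K F γ),
              MNLBandit.regret 𝒟 A fstar T ≤
                C * (K : ℝ) ^ 2 *
                  √((N : ℝ) * T * Real.log (max (K / β) 2) * Real.log (M * T))) ∧
    -- linear class
    (∃ C : ℝ, 0 < C ∧
      ∀ (N K T d : ℕ) (B : ℝ), 1 ≤ K → K ≤ N → 2 ≤ T → 1 ≤ d → 0 < B →
        ∃ γ : ℕ → ℝ, (∀ m, 0 < γ m) ∧
          ∀ 𝒳 : Set (Fin N → EuclideanSpace ℝ (Fin d)),
            (∀ x ∈ 𝒳, ∀ i, ‖x i‖ ≤ 1) →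
            ∀ fstar ∈ MNLBandit.linearClass 𝒳 B,
            ∀ (𝒟 : Measure (𝒳 × MNLBandit.Cube N)) [IsProbabilityMeasure 𝒟]
              (A : MNLBandit.BarrierERMAlgorithm K (MNLBandit.linearClass 𝒳 B) γ),
              MNLBandit.regret 𝒟 A fstar T ≤
                C * (K : ℝ) ^ 2 *
                  √((d : ℝ) * max B 2 * N * T * Real.log (max B 2) * Real.log T)) := by
  refine ⟨⟨8032, by norm_num, fun N K T M β hK hKN hT hβ _ => ⟨_,
    MNLBandit.barrierParam_pos (hK.trans hKN) (L := max (Real.log (M * T)) (1 / 4)) (by positivity),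
    fun X _ F hF hM hFm fstar hf 𝒟 _ A =>
      MNLBandit.regret_finite_le hK hKN hT hβ hF hM hFm hf 𝒟 A⟩⟩,
    20080, by norm_num, fun N K T d B hK hKN hT hd hB => ⟨_,
    MNLBandit.barrierParam_pos (hK.trans hKN)
      (L := 18 * d * Real.log (max B 2) * Real.log T) ?_,
    fun 𝒳 h𝒳 fstar hf 𝒟 _ A => MNLBandit.regret_linear_le hK hKN hT hd hB h𝒳 hf 𝒟 A⟩⟩
  have h1 := MNLBandit.two_thirds_le_log (le_max_right B 2)
  have h2 := MNLBandit.two_thirds_le_log (show (2 : ℝ) ≤ T by exact_mod_cast hT)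
  have h3 : (0 : ℝ) < d := by exact_mod_cast hd
  positivity
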